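/- Let $a_j\ge 0$ ($j\ge 0$, $j\ne 1$) with $0<a_0<-a_1=\sum_{j\ne1}a_j<\infty$ and $b_j\ge0$ ($j\ge1$) with $0<-b_0=\sum_{j\ge1}b_j<\infty$; put $f(s)=\sum_{j\ge0} a_js^j$, $g(s)=\sum_{j\ge0} b_js^j$, and assume criticality, $\sum_j ja_j=0$. The Markov branching process with immigration (MBPI) is the homogeneous continuous-time Markov chain on $\{0,1,2,\dots\}$ whose transition functions $p_{ij}(t)$ satisfy $\sum_j p_{ij}(t)=1$ and $$p_{ij}(\varepsilon)=\delta_{ij}+\bigl(i\,a_{j-i+1}+b_{j-i}\bigr)\varepsilon+o(\varepsilon)\qquad(\varepsilon\downarrow0)$$ (with $\delta_{ij}$ the Kronecker symbol and $a_k=b_k=0$ for $k<0$). Put $\mathcal P(t;s)=\sum_j p_{0j}(t)s^j$, and let $F(t;s)$ be the generating function at time $t$ of the process without immigration (all $b_j=0$) started from one individual. Assume that for all $s\in[0,1)$ $$f(s)=(1-s)^{1+\nu}\mathcal L\Bigl(\frac1{1-s}\Bigr),\qquad g(s)=-(1-s)^{\delta}\ell\Bigl(\frac1{1-s}\Bigr),$$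 where $0<\nu,\delta<1$ and $\mathcal L,\ell$ are slowly varying at infinity. Put $\gamma=\delta-\nu$, $\mu=2\delta-\nu$, $\tau(t)=1/(1-F(t;0))$ and $T(t)=\tau(t)^{|\gamma|}$. Suppose that $\gamma<0$, $\mu>0$ and $$\frac{\ell(x)}{\mathcal L(x)}=|\gamma|+O\bigl(\ell(x)/x^{\delta}\bigr)\qquad(x\to\infty).$$ Then, for $s\in[0,1)$, $e^{T(t)}\mathcal P(t;s)=\pi(s)\,(1+\rho(t;s))$, where $$\pi(s)=\exp\Bigl\{\frac1{(1-s)^{|\gamma|}}+\int_s^1\Bigl[\frac{g(u)}{f(u)}+\frac{|\gamma|}{(1-u)^{1+|\gamma|}}\Bigr]du\Bigr\}$$ (the integral converges) and, for each $r<1$, $\rho(t;s)\to0$ as $t\to\infty$ uniformly in $s\in[0,r]$. The function $\pi$ has a power series expansion $\pi(s)=\sum_{j\ge0}\pi_js^j$ on $[0,1)$, and $\{\pi_j\}$ is an invariant measure for the MBPI: $\pi_j\ge0$, not all $\pi_j$ vanish, and $\pi_j=\sum_i\pi_ip_{ij}(t)$ for all $t\ge 0$ and $j$. Suppose in addition that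 - $[\mathcal L_\nu]$: $\mathcal L(cx)/\mathcal L(x)=1+O(\alpha(x))$ as $x\to\infty$ for each $c>0$, where $\alpha$ is positive, decreasing, tends to $0$, and $\alpha(x)=O(\mathcal L(x)/x^{\nu})$; - $[\ell_\delta]$: $\ell(cx)/\ell(x)=1+O(\beta(x))$ as $x\to\infty$ for each $c>0$, where $\beta$ is positive, decreasing, tends to $0$, and $\beta(x)=O(\ell(x)/x^{\delta})$. Then, for each $r<1$, $$\rho(t;s)=O\bigl(\ell(\tau(t))/\tau(t)^{\mu}\bigr)\qquad(t\to\infty)\quad\text{uniformly in } s\in[0,r],$$ and for all $i,j\ge 0$ $$e^{T(t)}p_{ij}(t)=\pi_j\Bigl(1+O\bigl(\ell(\tau(t))/\tau(t)^{\mu}\bigr)\Bigr)\qquad(t\to\infty).$$ -/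

import Mathlib

open Filter Topology Asymptotics Set MeasureTheory

namespace BranchingImmigration

/-- Offspring intensities: `a j ≥ 0` for `j ≠ 1` and `0 < a 0 < -a 1 = ∑_{j ≠ 1} a j < ∞`. -/
structure IsOffspring (a : ℕ → ℝ) : Prop where
  nonneg : ∀ j, j ≠ 1 → 0 ≤ a j
  zero_pos : 0 < a 0
  zero_lt : a 0 < -a 1
  hasSum : HasSum (fun j => if j = 1 then 0 else a j) (-a 1)

/-- Immigration intensities: `b j ≥ 0` for `j ≥ 1` and `0 < -b 0 = ∑_{j ≥ 1} b j < ∞`. -/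
structure IsImmigration (b : ℕ → ℝ) : Prop where
  nonneg : ∀ j, j ≠ 0 → 0 ≤ b j
  zero_neg : 0 < -b 0
  hasSum : HasSum (fun j => b (j + 1)) (-b 0)

/-- Criticality: `∑ j a_j = 0`. -/
def IsCritical (a : ℕ → ℝ) : Prop := HasSum (fun j : ℕ => (j : ℝ) * a j) 0

/-- The generating function `∑ c_j s^j`. -/
noncomputable def gf (c : ℕ → ℝ) (s : ℝ) : ℝ := ∑' j, c j * s ^ j

/-- Transition rates of the branching process with immigration: from `i` to `j`, each of the `i`
individuals turns into `j - i + 1` ones with intensity `a (j - i + 1)`, and `j - i` immigrants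
arrive with intensity `b (j - i)`. The diagonal entry is `i * a 1 + b 0`. -/
noncomputable def rates (a b : ℕ → ℝ) (i j : ℕ) : ℝ :=
  (if i ≤ j + 1 then (i : ℝ) * a (j + 1 - i) else 0) + (if i ≤ j then b (j - i) else 0)

/-- `p t i j` is the (honest) transition function of a homogeneous continuous-time Markov chain
on `ℕ` with infinitesimal transition rates `q`:
`p ε i j = δ_ij + q i j * ε + o(ε)` as `ε ↓ 0`. -/
structure IsTransitionFunction (q : ℕ → ℕ → ℝ) (p : ℝ → ℕ → ℕ → ℝ) : Prop where
  nonneg : ∀ t, 0 ≤ t → ∀ i j, 0 ≤ p t i j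
  hasSum_one : ∀ t, 0 ≤ t → ∀ i, HasSum (fun j => p t i j) 1
  zero : ∀ i j, p 0 i j = if i = j then 1 else 0
  chapman_kolmogorov : ∀ s t, 0 ≤ s → 0 ≤ t → ∀ i j,
    HasSum (fun k => p s i k * p t k j) (p (s + t) i j)
  rate : ∀ i j, HasDerivWithinAt (fun t => p t i j) (q i j) (Ici 0) 0

/-- `p` is the transition function of the Markov branching process with immigration. -/
def IsMBPI (a b : ℕ → ℝ) (p : ℝ → ℕ → ℕ → ℝ) : Prop := IsTransitionFunction (rates a b) p

/-- `z` is the transition function of the Markov branching process without immigration. -/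
def IsMBP (a : ℕ → ℝ) (z : ℝ → ℕ → ℕ → ℝ) : Prop := IsTransitionFunction (rates a (fun _ => 0)) z

/-- A nonzero measure on `ℕ` invariant for the transition function `p`. -/
structure IsInvariantMeasure (p : ℝ → ℕ → ℕ → ℝ) (m : ℕ → ℝ) : Prop where
  nonneg : ∀ j, 0 ≤ m j
  ne_zero : ∃ j, m j ≠ 0
  invariant : ∀ t, 0 ≤ t → ∀ j, HasSum (fun i => m i * p t i j) (m j)

/-- Slow variation at infinity in the sense of Karamata. -/
structure SlowlyVarying (L : ℝ → ℝ) : Prop where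
  pos_measurable : ∃ X : ℝ, (∀ x, X ≤ x → 0 < L x) ∧ Measurable (fun x : Ici X => L x)
  tendsto : ∀ c : ℝ, 0 < c → Tendsto (fun x => L (c * x) / L x) atTop (𝓝 1)

/-- `L (c x) / L x = 1 + O(α x)` as `x → ∞` for each `c > 0`, where `α` is positive, decreasing,
tends to `0`, and `α x = O(L x / x ^ κ)`. -/
def HasRemainder (L : ℝ → ℝ) (κ : ℝ) : Prop :=
  ∃ α : ℝ → ℝ, (∃ X : ℝ, (∀ x, X ≤ x → 0 < α x) ∧ AntitoneOn α (Ici X)) ∧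
    Tendsto α atTop (𝓝 0) ∧
    (∀ c : ℝ, 0 < c → (fun x => L (c * x) / L x - 1) =O[atTop] α) ∧
    α =O[atTop] (fun x => L x / x ^ κ)

/-- `F(t;s)`, the generating function at time `t` of the process without immigration (with
transition function `z`) started from one individual. -/
noncomputable def F (z : ℝ → ℕ → ℕ → ℝ) (t s : ℝ) : ℝ := gf (z t 1) s

/-- `𝒫(t;s) = ∑ p_{0j}(t) s^j`. -/
noncomputable def P (p : ℝ → ℕ → ℕ → ℝ) (t s : ℝ) : ℝ := gf (p t 0) s

/-- The factor `𝒩(t)`, defined by `1 / (1 - F(t;0)) = (ν t)^(1/ν) / 𝒩(t)`. -/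
noncomputable def scaleN (ν : ℝ) (z : ℝ → ℕ → ℕ → ℝ) (t : ℝ) : ℝ :=
  (ν * t) ^ (1 / ν) * (1 - F z t 0)

/-- `τ(t) = (ν t)^(1/ν) / 𝒩(t)`; for `t > 0` this is `1 / (1 - F(t;0))`. -/
noncomputable def tau (ν : ℝ) (z : ℝ → ℕ → ℕ → ℝ) (t : ℝ) : ℝ :=
  (ν * t) ^ (1 / ν) / scaleN ν z t

/-- `T(t) = τ(t)^|γ|` with `γ = δ - ν`. -/
noncomputable def bigT (ν δ : ℝ) (z : ℝ → ℕ → ℕ → ℝ) (t : ℝ) : ℝ := tau ν z t ^ |δ - ν|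

/-- The integrand `g(u)/f(u) + |γ| / (1-u)^(1+|γ|)`, `γ = δ - ν`. -/
noncomputable def piIntegrand (a b : ℕ → ℝ) (ν δ u : ℝ) : ℝ :=
  gf b u / gf a u + |δ - ν| / (1 - u) ^ (1 + |δ - ν|)

/-- `π(s) = exp (1/(1-s)^|γ| + ∫_s^1 [g(u)/f(u) + |γ|/(1-u)^(1+|γ|)] du)`. -/
noncomputable def limitPi (a b : ℕ → ℝ) (ν δ s : ℝ) : ℝ :=
  Real.exp (1 / (1 - s) ^ |δ - ν| + ∫ u in s..1, piIntegrand a b ν δ u)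

/-- The error bound `ℓ(τ(t)) / τ(t)^μ` with `μ = 2δ - ν`. -/
noncomputable def errRate (ν δ : ℝ) (ell : ℝ → ℝ) (z : ℝ → ℕ → ℕ → ℝ) (t : ℝ) : ℝ :=
  ell (tau ν z t) / tau ν z t ^ (2 * δ - ν)

end BranchingImmigration

open BranchingImmigration

/-!
The proof works with the generating functions of the transition probabilities.

*Solution in closed form.* The rates are conservative and the chain is honest, so the difference
quotients of `p h i ·` at `h = 0` converge in `ℓ¹` and the backward equation holds for
`t ↦ ∑ j, p t i j * s ^ j`, with a right derivative. Bounded solutions of the backward equation are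
unique (`backward_unique`), by a maximum principle with barriers built from `1 - σ ^ i`, `σ → 1`;
linear barriers are not available because the immigration law has infinite mean. As
`i ↦ G ^ i * exp (∫_s^G g / f)` is a solution when `G` follows the flow `G' = f(G)`, `G(0) = s`, one
gets `F(t;s) = G(t)` and `∑ j, p t i j * s ^ j = F ^ i * exp (∫_s^F g / f)` (`isFlow_F`).

*Asymptotics.* Write `κ = |γ| = ν - δ`, `x = F(t;0)`, `y = F(t;s)`. The definition of `π` gives
`π(s) = π(y) exp (∫_s^y g / f)`, hence
`1 + ρ(t;s) = exp ((1 - x) ^ (-κ) - (1 - y) ^ (-κ) - ∫_y^1 [g / f + κ (1 - u) ^ (-1 - κ)] du)`.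
By the hypothesis on `ℓ / L` the integrand is `O((1 - u) ^ (-1 - κ) * (-g(u)))`. Since `-g` is
monotone and regularly varying at `1` with index `δ > κ`, Potter's bound makes the integral
`O((1 - x) ^ (-κ) * (-g(x)))`, which is the error rate `ℓ(τ) / τ ^ μ`. The difference of the two
powers is at most a multiple of `-g(x)` times the time the flow takes from `x` to `y`, which is the fixed
time it takes from `0` to `s` (`exists_log_limitPi_sub_le`).

*Coefficients.* Uniform estimates on a real interval do not control the coefficients. Instead,
equating the forward and backward equations gives `∑ m, p t 0 m * q m j = ∑ k, b k * p t k j`, a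
recursion for `p t 0 (j + 1)`. Its right-hand side equals `∑ k, b k * (p t k j - p t 0 j)`, and is
small since `|p t k j - p t 0 j|` is at most `1 - F(t;0) ^ k`, the survival probability of the
descendants of `k` ancestors, times `∑ m ≤ j, p t 0 m` (`exists_coeff_limit`). Invariance of the
limits `π_j` is the identity `π(F(t;s)) 𝒫(t;s) = π(s)`, and they are positive because every state
can be reached from `0`.
-/

namespace BranchingImmigration

/-! ### Generating functions -/

lemma summable_mul_pow {c : ℕ → ℝ} (hc : Summable c) {x : ℝ} (h0 : 0 ≤ x) (h1 : x ≤ 1) :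
    Summable fun j => c j * x ^ j := by
  refine Summable.of_norm_bounded hc.abs fun j => ?_
  rw [norm_mul, Real.norm_eq_abs, norm_pow, Real.norm_eq_abs, abs_of_nonneg h0]
  exact mul_le_of_le_one_right (abs_nonneg _) (pow_le_one₀ h0 h1)

lemma hasSum_gf {c : ℕ → ℝ} (hc : Summable c) {x : ℝ} (h0 : 0 ≤ x) (h1 : x ≤ 1) :
    HasSum (fun j => c j * x ^ j) (gf c x) :=
  (summable_mul_pow hc h0 h1).hasSum

lemma gf_zero (c : ℕ → ℝ) : gf c 0 = c 0 := by
  unfold gf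
  rw [tsum_eq_single 0 (fun j hj => by simp [hj])]
  simp

lemma gf_one (c : ℕ → ℝ) : gf c 1 = ∑' j, c j := by
  simp [gf]

lemma continuousOn_gf {c : ℕ → ℝ} (hc : Summable c) : ContinuousOn (gf c) (Icc 0 1) := by
  refine continuousOn_tsum (u := fun j => |c j|) (fun j => by fun_prop) hc.abs fun j x hx => ?_
  rw [norm_mul, Real.norm_eq_abs, norm_pow, Real.norm_eq_abs, abs_of_nonneg hx.1]
  exact mul_le_of_le_one_right (abs_nonneg _) (pow_le_one₀ hx.1 hx.2)

lemma summable_succ_mul_pow {c : ℕ → ℝ} {M : ℝ} (hM : ∀ j, |c j| ≤ M) {x : ℝ} (h0 : 0 ≤ x)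
    (h1 : x < 1) : Summable fun j : ℕ => (j : ℝ) * c j * x ^ (j - 1) := by
  have h := (summable_pow_mul_geometric_of_norm_lt_one 1
    (show ‖x‖ < 1 by rwa [Real.norm_eq_abs, abs_of_nonneg h0]))
  have h2 := (summable_geometric_of_lt_one h0 h1)
  rw [← summable_nat_add_iff 1]
  refine Summable.of_norm_bounded ((h.add h2).mul_left M) fun j => ?_
  have : (0 : ℝ) ≤ j := j.cast_nonneg
  simp only [Nat.cast_add, Nat.cast_one, add_tsub_cancel_right, pow_one]
  rw [norm_mul, norm_mul, Real.norm_eq_abs, Real.norm_eq_abs, norm_pow, Real.norm_eq_abs,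
    abs_of_nonneg h0, abs_of_nonneg (by positivity)]
  have h3 := hM (j + 1)
  calc ((j : ℝ) + 1) * |c (j + 1)| * x ^ j ≤ (j + 1) * M * x ^ j := by gcongr
    _ = _ := by ring

lemma hasDerivAt_gf {c : ℕ → ℝ} {M : ℝ} (hM : ∀ j, |c j| ≤ M) {x : ℝ} (h0 : 0 < x)
    (h1 : x < 1) : HasDerivAt (gf c) (∑' j : ℕ, (j : ℝ) * c j * x ^ (j - 1)) x := by
  obtain ⟨r, hxr, hr⟩ := exists_between h1
  have hr0 : 0 < r := h0.trans hxr
  have habs : ∀ j, |(fun j => |c j|) j| ≤ M := fun j => by simpa using hM j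
  refine hasDerivAt_tsum_of_isPreconnected (t := Ioo 0 r)
    (g := fun j y => c j * y ^ j) (y₀ := x)
    (summable_succ_mul_pow habs hr0.le hr) isOpen_Ioo isPreconnected_Ioo
    (g' := fun j y => (j : ℝ) * c j * y ^ (j - 1)) (fun j y hy => ?_) (fun j y hy => ?_)
    ⟨h0, hxr⟩ ?_ ⟨h0, hxr⟩
  · exact ((hasDerivAt_pow j y).const_mul (c j)).congr_deriv (by ring)
  · rw [norm_mul, norm_mul, norm_pow, Real.norm_eq_abs, Real.norm_eq_abs, Real.norm_eq_abs,
      abs_of_nonneg hy.1.le, Nat.abs_cast]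
    have := hy.1.le
    have := hy.2.le
    gcongr
  · refine Summable.of_norm_bounded ((summable_geometric_of_lt_one h0.le h1).mul_left M)
      fun j => ?_
    rw [norm_mul, norm_pow, Real.norm_eq_abs, Real.norm_eq_abs, abs_of_nonneg h0.le]
    gcongr
    exact hM j

/-- Uniqueness of power series coefficients, from values on `(0, 1)` only. -/
lemma coeff_eq_zero {c : ℕ → ℝ} (h : ∀ x : ℝ, 0 < x → x < 1 → HasSum (fun j => c j * x ^ j) 0)
    (n : ℕ) : c n = 0 := by
  induction n using Nat.strong_induction_on with
  | _ n ih =>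
    -- rescaling by `1 / 2` makes the coefficients summable, hence the sum continuous at `0`
    set d : ℕ → ℝ := fun j => c (j + n) * (1 / 2) ^ j with hd
    have key : ∀ x : ℝ, 0 < x → x < 1 → HasSum (fun j => c (j + n) * x ^ j) 0 := by
      intro x h0 h1
      have h2 : HasSum (fun j => c (j + n) * x ^ (j + n)) 0 := by
        have := (hasSum_nat_add_iff (f := fun j => c j * x ^ j) (g := 0) n).2
        refine this ?_
        rw [Finset.sum_eq_zero (fun i hi => by rw [ih i (Finset.mem_range.1 hi), zero_mul]),
          add_zero]
        exact h x h0 h1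
      have h3 := h2.mul_left ((x ^ n)⁻¹)
      rw [mul_zero] at h3
      refine h3.congr_fun fun j => ?_
      have : x ^ n ≠ 0 := (pow_pos h0 n).ne'
      rw [pow_add]
      field_simp
    have hsum : Summable d := (key (1 / 2) (by norm_num) (by norm_num)).summable
    have hcont := continuousOn_gf hsum 0 (by simp)
    have hz : ∀ x ∈ Ioo (0 : ℝ) 1, gf d x = 0 := by
      intro x hx
      have := (key (1 / 2 * x) (by linarith [hx.1]) (by linarith [hx.2])).tsum_eq
      rw [← this]
      unfold gf
      refine tsum_congr fun j => ?_
      rw [hd, mul_pow]; ring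
    have hlim : Tendsto (gf d) (𝓝[Ioo 0 1] 0) (𝓝 (gf d 0)) :=
      hcont.mono_left (nhdsWithin_mono _ Ioo_subset_Icc_self)
    have : (𝓝[Ioo (0 : ℝ) 1] 0).NeBot := by
      rw [nhdsWithin_Ioo_eq_nhdsGT one_pos]; infer_instance
    have h0 : gf d 0 = 0 := by
      refine tendsto_nhds_unique (hlim.congr' ?_) tendsto_const_nhds
      filter_upwards [self_mem_nhdsWithin] with x hx using hz x hx
    rw [gf_zero] at h0
    simpa [hd] using h0

lemma coeff_ext {c d : ℕ → ℝ} {S : ℝ → ℝ}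
    (hc : ∀ x : ℝ, 0 < x → x < 1 → HasSum (fun j => c j * x ^ j) (S x))
    (hd : ∀ x : ℝ, 0 < x → x < 1 → HasSum (fun j => d j * x ^ j) (S x)) (n : ℕ) : c n = d n := by
  rw [← sub_eq_zero]
  refine coeff_eq_zero (c := fun j => c j - d j) (fun x h0 h1 => ?_) n
  simpa [sub_mul] using (hc x h0 h1).sub (hd x h0 h1)

/-! ### The rates -/

lemma hasSum_shift {c : ℕ → ℝ} {S : ℝ} (h : HasSum c S) (n : ℕ) :
    HasSum (fun m => if n ≤ m then c (m - n) else 0) S := by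
  have hi : Function.Injective fun m : ℕ => m + n := add_left_injective n
  rw [← hi.hasSum_iff]
  · simpa [Function.comp_def] using h
  · intro x hx
    rw [if_neg]
    intro hn
    exact hx ⟨x - n, by simp [hn]⟩

/-- The generator maps `j ↦ x ^ j` to `i ↦ i x ^ (i - 1) f(x) + x ^ i g(x)`. -/
lemma hasSum_rates_mul_pow {a b : ℕ → ℝ} (ha : Summable a) (hb : Summable b) {x : ℝ} (h0 : 0 ≤ x)
    (h1 : x ≤ 1) (i : ℕ) : HasSum (fun j => rates a b i j * x ^ j)
      (i * x ^ (i - 1) * gf a x + x ^ i * gf b x) := by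
  have hA : HasSum (fun j => (if i ≤ j + 1 then (i : ℝ) * a (j + 1 - i) else 0) * x ^ j)
      (i * x ^ (i - 1) * gf a x) := by
    cases i with
    | zero => simp [hasSum_zero]
    | succ n =>
      have h := hasSum_shift ((hasSum_gf ha h0 h1).mul_left (((n + 1 : ℕ) : ℝ) * x ^ n)) n
      rw [Nat.add_sub_cancel]
      refine h.congr_fun fun m => ?_
      simp only [add_le_add_iff_right, Nat.add_sub_add_right]
      split_ifs with hnm
      · obtain ⟨k, rfl⟩ := Nat.exists_eq_add_of_le hnm
        rw [Nat.add_sub_cancel_left, pow_add]; ring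
      · simp
  have hB : HasSum (fun j => (if i ≤ j then b (j - i) else 0) * x ^ j) (x ^ i * gf b x) := by
    have h := hasSum_shift ((hasSum_gf hb h0 h1).mul_left (x ^ i)) i
    refine h.congr_fun fun m => ?_
    split_ifs with hnm
    · obtain ⟨k, rfl⟩ := Nat.exists_eq_add_of_le hnm
      rw [Nat.add_sub_cancel_left, pow_add]; ring
    · simp
  simpa only [rates, add_mul] using hA.add hB

lemma rates_nonneg {a b : ℕ → ℝ} (ha : ∀ j, j ≠ 1 → 0 ≤ a j) (hb : ∀ j, j ≠ 0 → 0 ≤ b j)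
    {i j : ℕ} (hij : i ≠ j) : 0 ≤ rates a b i j := by
  unfold rates
  refine add_nonneg ?_ ?_
  · split_ifs with h
    · exact mul_nonneg i.cast_nonneg (ha _ (by omega))
    · exact le_rfl
  · split_ifs with h
    · exact hb _ (by omega)
    · exact le_rfl

lemma rates_eq_zero (a b : ℕ → ℝ) {i j : ℕ} (h : j + 1 < i) : rates a b i j = 0 := by
  simp [rates, show ¬ i ≤ j + 1 by omega, show ¬ i ≤ j by omega]

lemma rates_succ (a b : ℕ → ℝ) (j : ℕ) : rates a b (j + 1) j = (j + 1) * a 0 := by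
  simp [rates]

lemma abs_rates_le (a b : ℕ → ℝ) (i j : ℕ) :
    |rates a b i j| ≤ rates (fun k => |a k|) (fun k => |b k|) i j := by
  unfold rates
  refine (abs_add_le _ _).trans (add_le_add ?_ ?_)
  · split_ifs
    · rw [abs_mul, Nat.abs_cast]
    · simp
  · split_ifs <;> simp

/-! ### Offspring and immigration generating functions -/

namespace IsOffspring
variable {a : ℕ → ℝ}

lemma hasSum_zero (ha : IsOffspring a) : HasSum a 0 := by
  have h := ha.hasSum.add (hasSum_ite_eq 1 (a 1))
  rw [neg_add_cancel] at h
  refine h.congr_fun fun j => ?_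
  by_cases hj : j = 1 <;> simp [hj]

/-- By criticality `f(s) = ∑ a_j (s ^ j - 1 - j (s - 1))`, a sum of nonnegative terms. -/
lemma hasSum_gf_critical (ha : IsOffspring a) (hc : IsCritical a) {s : ℝ} (h0 : 0 ≤ s)
    (h1 : s ≤ 1) : HasSum (fun j : ℕ => a j * (s ^ j - 1 - j * (s - 1))) (gf a s) := by
  have h := ((hasSum_gf ha.hasSum_zero.summable h0 h1).sub ha.hasSum_zero).sub
    (hc.mul_right (s - 1))
  rw [zero_mul, sub_zero, sub_zero] at h
  exact h.congr_fun fun j => by ring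

lemma term_nonneg (ha : IsOffspring a) {s : ℝ} (h0 : 0 ≤ s) (j : ℕ) :
    0 ≤ a j * (s ^ j - 1 - j * (s - 1)) := by
  by_cases hj : j = 1
  · simp [hj]
  · refine mul_nonneg (ha.nonneg j hj) ?_
    have := one_add_mul_le_pow (show (-2 : ℝ) ≤ s - 1 by linarith) j
    rw [add_sub_cancel] at this
    linarith

lemma exists_pos (ha : IsOffspring a) : ∃ j, 2 ≤ j ∧ 0 < a j := by
  by_contra! h
  have h2 : ∀ j, j ≠ 0 → (if j = 1 then 0 else a j) = 0 := by
    intro j hj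
    split_ifs with h1
    · rfl
    · exact le_antisymm (h j (by omega)) (ha.nonneg j h1)
  have h3 := ha.hasSum.tsum_eq
  rw [tsum_eq_single 0 h2] at h3
  have := ha.zero_lt
  simp at h3
  linarith

lemma gf_pos (ha : IsOffspring a) (hc : IsCritical a) {s : ℝ} (h0 : 0 ≤ s) (h1 : s < 1) :
    0 < gf a s := by
  obtain ⟨j, hj, hpos⟩ := ha.exists_pos
  have h := ha.hasSum_gf_critical hc h0 h1.le
  refine lt_of_lt_of_le ?_ (le_hasSum h j fun i _ => ha.term_nonneg h0 i)
  refine mul_pos hpos ?_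
  have := one_add_mul_self_lt_rpow_one_add (show (-1 : ℝ) ≤ s - 1 by linarith)
    (by linarith) (show (1 : ℝ) < (j : ℝ) by exact_mod_cast hj)
  rw [add_sub_cancel, Real.rpow_natCast] at this
  linarith

lemma gf_one_eq (ha : IsOffspring a) : gf a 1 = 0 := by
  rw [gf_one, ha.hasSum_zero.tsum_eq]

lemma gf_nonneg (ha : IsOffspring a) (hc : IsCritical a) {s : ℝ} (h0 : 0 ≤ s) (h1 : s ≤ 1) :
    0 ≤ gf a s := by
  rcases h1.lt_or_eq with h | rfl
  · exact (ha.gf_pos hc h0 h).le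
  · rw [ha.gf_one_eq]

lemma gf_le (ha : IsOffspring a) {s : ℝ} (h0 : 0 ≤ s) (h1 : s ≤ 1) :
    gf a s ≤ -a 1 * (1 - s) := by
  have h := (hasSum_gf ha.hasSum_zero.summable h0 h1).sub ha.hasSum_zero
  rw [sub_zero] at h
  have h2 := hasSum_ite_eq 1 (-a 1 * (1 - s))
  refine hasSum_le (fun j => ?_) h h2
  by_cases hj : j = 1
  · simp [hj]; linarith
  · simp only [hj, if_false]
    have := mul_nonneg (ha.nonneg j hj) (sub_nonneg.2 (pow_le_one₀ h0 h1 (n := j)))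
    linarith

end IsOffspring

lemma IsImmigration.hasSum_zero {b : ℕ → ℝ} (hb : IsImmigration b) : HasSum b 0 := by
  have := (hasSum_nat_add_iff (f := b) 1).1 hb.hasSum
  simpa using this

lemma neg_gf_eq {b : ℕ → ℝ} (hb : HasSum b 0) {s : ℝ} (h0 : 0 ≤ s) (h1 : s ≤ 1) :
    HasSum (fun j => b j * (1 - s ^ j)) (-gf b s) := by
  have h := hb.sub (hasSum_gf hb.summable h0 h1)
  rw [zero_sub] at h
  exact h.congr_fun fun j => by ring

lemma term_immigration_nonneg {b : ℕ → ℝ} (hn : ∀ j, j ≠ 0 → 0 ≤ b j) {s : ℝ} (h0 : 0 ≤ s)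
    (h1 : s ≤ 1) (j : ℕ) : 0 ≤ b j * (1 - s ^ j) := by
  by_cases hj : j = 0
  · simp [hj]
  · exact mul_nonneg (hn j hj) (sub_nonneg.2 (pow_le_one₀ h0 h1))

lemma neg_gf_nonneg {b : ℕ → ℝ} (hn : ∀ j, j ≠ 0 → 0 ≤ b j) (hb : HasSum b 0) {s : ℝ}
    (h0 : 0 ≤ s) (h1 : s ≤ 1) : 0 ≤ -gf b s :=
  (neg_gf_eq hb h0 h1).nonneg fun j => term_immigration_nonneg hn h0 h1 j

lemma neg_gf_antitone {b : ℕ → ℝ} (hn : ∀ j, j ≠ 0 → 0 ≤ b j) (hb : HasSum b 0) {s t : ℝ}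
    (h0 : 0 ≤ s) (hst : s ≤ t) (h1 : t ≤ 1) : -gf b t ≤ -gf b s := by
  refine hasSum_le (fun j => ?_) (neg_gf_eq hb (h0.trans hst) h1) (neg_gf_eq hb h0 (hst.trans h1))
  by_cases hj : j = 0
  · simp [hj]
  · have := hn j hj
    gcongr

lemma IsImmigration.exists_pos {b : ℕ → ℝ} (hb : IsImmigration b) : ∃ m, m ≠ 0 ∧ 0 < b m := by
  by_contra! h
  have h2 : (fun j => b (j + 1)) = 0 := by
    funext j
    exact le_antisymm (h _ (by omega)) (hb.nonneg _ (by omega))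
  have h3 := hb.hasSum
  rw [h2] at h3
  have := h3.unique _root_.hasSum_zero
  have := hb.zero_neg
  linarith

/-- A lower bound for `-g` linear in `1 - s`: some positive `b_m` contributes `b_m (1 - s ^ m)`. -/
lemma IsImmigration.le_neg_gf {b : ℕ → ℝ} (hb : IsImmigration b) :
    ∃ c, 0 < c ∧ ∀ s : ℝ, 0 ≤ s → s ≤ 1 → c * (1 - s) ≤ -gf b s := by
  obtain ⟨m, hm, hpos⟩ := hb.exists_pos
  refine ⟨b m, hpos, fun s h0 h1 => ?_⟩
  refine le_trans ?_ (le_hasSum (neg_gf_eq hb.hasSum_zero h0 h1) m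
    fun i _ => term_immigration_nonneg hb.nonneg h0 h1 i)
  have := pow_le_of_le_one h0 h1 hm
  gcongr

/-! ### Interchanging sums -/

lemma summable_mul_of_abs_le {c : ℕ → ℝ} {d e : ℕ → ℕ → ℝ} {E : ℕ → ℝ}
    (hde : ∀ k j, |d k j| ≤ e k j) (he : ∀ k, HasSum (e k) (E k))
    (hcE : Summable fun k => |c k| * E k) : Summable fun x : ℕ × ℕ => c x.1 * d x.1 x.2 := by
  have h0 : ∀ k j, 0 ≤ e k j := fun k j => (abs_nonneg _).trans (hde k j)
  have h2 : Summable fun x : ℕ × ℕ => |c x.1| * e x.1 x.2 := by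
    have hn : (0 : ℕ × ℕ → ℝ) ≤ fun x => |c x.1| * e x.1 x.2 :=
      fun x => mul_nonneg (abs_nonneg _) (h0 _ _)
    rw [summable_prod_of_nonneg hn]
    have h3 : ∀ k, HasSum (fun j => |c k| * e k j) (|c k| * E k) := fun k => (he k).mul_left |c k|
    refine ⟨fun k => (h3 k).summable, ?_⟩
    simp only [(h3 _).tsum_eq]
    exact hcE
  refine Summable.of_norm_bounded h2 fun x => ?_
  rw [norm_mul]
  exact mul_le_mul_of_nonneg_left (hde _ _) (abs_nonneg _)

lemma hasSum_tsum_mul_comm {c : ℕ → ℝ} {d e : ℕ → ℕ → ℝ} {D E : ℕ → ℝ}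
    (hde : ∀ k j, |d k j| ≤ e k j) (he : ∀ k, HasSum (e k) (E k))
    (hcE : Summable fun k => |c k| * E k) (hd : ∀ k, HasSum (d k) (D k)) :
    HasSum (fun j => ∑' k, c k * d k j) (∑' k, c k * D k) := by
  have h := summable_mul_of_abs_le hde he hcE
  have h1 : ∑' k, c k * D k = ∑' x : ℕ × ℕ, c x.1 * d x.1 x.2 := by
    rw [h.tsum_prod]
    exact tsum_congr fun k => ((hd k).mul_left (c k)).tsum_eq.symm
  have h2 := h.prod_symm
  rw [h1, ← (Equiv.prodComm ℕ ℕ).tsum_eq]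
  exact h2.hasSum.prod_fiberwise fun j => (h2.prod_factor j).hasSum

/-! ### The backward equation -/

section Semigroup
variable {q : ℕ → ℕ → ℝ} {p : ℝ → ℕ → ℕ → ℝ}

namespace IsTransitionFunction

lemma le_one (hp : IsTransitionFunction q p) {t : ℝ} (ht : 0 ≤ t) (i j : ℕ) : p t i j ≤ 1 :=
  le_hasSum (hp.hasSum_one t ht i) j fun k _ => hp.nonneg t ht i k

lemma summable_mul (hp : IsTransitionFunction q p) {t : ℝ} (ht : 0 ≤ t) (i : ℕ) {φ : ℕ → ℝ}
    (hφ : ∀ k, |φ k| ≤ 1) : Summable fun k => p t i k * φ k := by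
  refine Summable.of_norm_bounded (hp.hasSum_one t ht i).summable fun k => ?_
  rw [norm_mul, Real.norm_eq_abs, Real.norm_eq_abs, abs_of_nonneg (hp.nonneg t ht i k)]
  exact mul_le_of_le_one_right (hp.nonneg t ht i k) (hφ k)

lemma tendsto_quotient (hp : IsTransitionFunction q p) (i j : ℕ) :
    Tendsto (fun h => (p h i j - if i = j then 1 else 0) / h) (𝓝[>] 0) (𝓝 (q i j)) := by
  have h := (hasDerivWithinAt_iff_tendsto_slope' self_notMem_Ioi).1
    ((hp.rate i j).mono Ioi_subset_Ici_self)
  refine h.congr fun x => ?_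
  rw [slope_def_field, hp.zero, sub_zero]

/-- Since the chain is honest and its rates are conservative, the difference quotients of
`p h i ·` at `0` converge in `ℓ¹`, so they may be integrated against bounded functions. -/
lemma tendsto_generator (hp : IsTransitionFunction q p) {i : ℕ} (hq : ∀ k, k ≠ i → 0 ≤ q i k)
    (hs : HasSum (q i) 0) {φ : ℕ → ℝ} (hφ : ∀ k, |φ k| ≤ 1) :
    Tendsto (fun h => (∑' k, p h i k * φ k - φ i) / h) (𝓝[>] 0) (𝓝 (∑' k, q i k * φ k)) := by
  have hqs : Summable fun k => q i k * φ k := by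
    refine Summable.of_norm_bounded hs.summable.abs fun k => ?_
    rw [norm_mul]
    exact mul_le_of_le_one_right (abs_nonneg _) (hφ k)
  rw [Metric.tendsto_nhds]
  intro ε hε
  -- beyond `N` the rates have total mass less than `ε / 4`
  have htail : Tendsto (fun N => ∑ k ∈ Finset.range N, q i k) atTop (𝓝 0) := hs.tendsto_sum_nat
  obtain ⟨N, hN, hiN⟩ := ((htail.eventually (lt_mem_nhds (show -(ε / 4) < 0 by linarith))).and
    (eventually_gt_atTop i)).exists
  have hfin : Tendsto (fun h => ∑ k ∈ Finset.range N, (p h i k - if i = k then 1 else 0) / h)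
      (𝓝[>] 0) (𝓝 (∑ k ∈ Finset.range N, q i k)) :=
    tendsto_finsetSum _ fun k _ => hp.tendsto_quotient i k
  have hfinφ : Tendsto
      (fun h => ∑ k ∈ Finset.range N, (p h i k - if i = k then 1 else 0) / h * φ k)
      (𝓝[>] 0) (𝓝 (∑ k ∈ Finset.range N, q i k * φ k)) :=
    tendsto_finsetSum _ fun k _ => (hp.tendsto_quotient i k).mul_const _
  have hev1 := hfin.eventually (lt_mem_nhds (show -(ε / 4) < _ from hN))
  have hev2 := (Metric.tendsto_nhds.1 hfinφ) (ε / 4) (by linarith)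
  have htailq : |∑' k, q i (k + N) * φ (k + N)| ≤ ε / 4 := by
    have hsN : HasSum (fun k => q i (k + N)) (-∑ k ∈ Finset.range N, q i k) := by
      have := (hasSum_nat_add_iff' (f := q i) N).2 hs
      simpa using this
    have : |∑' k, q i (k + N) * φ (k + N)| ≤ -∑ k ∈ Finset.range N, q i k := by
      rw [← Real.norm_eq_abs]
      refine tsum_of_norm_bounded hsN fun k => ?_
      have h0 := hq (k + N) (by omega)
      rw [norm_mul, Real.norm_eq_abs, abs_of_nonneg h0]
      exact mul_le_of_le_one_right h0 (hφ _)
    linarith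
  filter_upwards [hev1, hev2, self_mem_nhdsWithin] with h h1 h2 (hh : 0 < h)
  have htailp : |(∑' k, p h i (k + N) * φ (k + N)) / h| ≤ ε / 4 := by
    have hsN : HasSum (fun k => p h i (k + N)) (1 - ∑ k ∈ Finset.range N, p h i k) :=
      (hasSum_nat_add_iff' (f := p h i) N).2 (hp.hasSum_one h hh.le i)
    have h3 : |∑' k, p h i (k + N) * φ (k + N)| ≤ 1 - ∑ k ∈ Finset.range N, p h i k := by
      rw [← Real.norm_eq_abs]
      refine tsum_of_norm_bounded hsN fun k => ?_
      have h0 := hp.nonneg h hh.le i (k + N)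
      rw [norm_mul, Real.norm_eq_abs, abs_of_nonneg h0]
      exact mul_le_of_le_one_right h0 (hφ _)
    have h4 : ∑ k ∈ Finset.range N, (p h i k - if i = k then 1 else 0) / h
        = -((1 - ∑ k ∈ Finset.range N, p h i k) / h) := by
      rw [← Finset.sum_div, Finset.sum_sub_distrib, Finset.sum_ite_eq,
        if_pos (Finset.mem_range.2 hiN)]
      ring
    rw [abs_div, abs_of_pos hh]
    rw [h4] at h1
    have := div_le_div_of_nonneg_right h3 hh.le
    linarith
  have hsplit1 : (∑' k, p h i k * φ k - φ i) / h
      = ∑ k ∈ Finset.range N, (p h i k - if i = k then 1 else 0) / h * φ k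
        + (∑' k, p h i (k + N) * φ (k + N)) / h := by
    rw [← (hp.summable_mul hh.le i hφ).sum_add_tsum_nat_add N]
    have : ∑ k ∈ Finset.range N, (p h i k - if i = k then 1 else 0) / h * φ k
        = (∑ k ∈ Finset.range N, p h i k * φ k - φ i) / h := by
      have h5 : φ i = ∑ k ∈ Finset.range N, if i = k then φ k else 0 := by
        rw [Finset.sum_ite_eq, if_pos (Finset.mem_range.2 hiN)]
      rw [h5, ← Finset.sum_sub_distrib, Finset.sum_div]
      refine Finset.sum_congr rfl fun k _ => ?_
      split_ifs <;> ring
    rw [this]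
    ring
  rw [hsplit1, ← hqs.sum_add_tsum_nat_add N]
  rw [Real.dist_eq] at h2 ⊢
  rw [abs_lt] at h2 ⊢
  rw [abs_le] at htailp htailq
  constructor <;> linarith [h2.1, h2.2, htailp.1, htailp.2, htailq.1, htailq.2]

/-- The semigroup property for the functions `t ↦ ∑ k, p t i k * φ k`. -/
lemma tsum_semigroup (hp : IsTransitionFunction q p) {s t : ℝ} (hs : 0 ≤ s) (ht : 0 ≤ t) (i : ℕ)
    {φ : ℕ → ℝ} (hφ : ∀ k, |φ k| ≤ 1) :
    ∑' j, p (s + t) i j * φ j = ∑' k, p s i k * ∑' j, p t k j * φ j := by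
  have h := hasSum_tsum_mul_comm (c := p s i) (e := p t) (d := fun k j => p t k j * φ j)
    (fun k j => ?_) (hp.hasSum_one t ht) (by simpa using (hp.hasSum_one s hs i).summable.abs)
    (fun k => (hp.summable_mul ht k hφ).hasSum)
  · rw [← h.tsum_eq]
    refine tsum_congr fun j => ?_
    rw [← (hp.chapman_kolmogorov s t hs ht i j).tsum_eq, ← tsum_mul_right]
    exact tsum_congr fun k => by ring
  · have h0 := hp.nonneg t ht k j
    rw [abs_mul, abs_of_nonneg h0]
    exact mul_le_of_le_one_right h0 (hφ j)

lemma abs_tsum_le (hp : IsTransitionFunction q p) {t : ℝ} (ht : 0 ≤ t) (i : ℕ)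
    {φ : ℕ → ℝ} (hφ : ∀ k, |φ k| ≤ 1) : |∑' k, p t i k * φ k| ≤ 1 := by
  rw [← Real.norm_eq_abs]
  refine tsum_of_norm_bounded (hp.hasSum_one t ht i) fun k => ?_
  have h0 := hp.nonneg t ht i k
  rw [norm_mul, Real.norm_eq_abs, abs_of_nonneg h0]
  exact mul_le_of_le_one_right h0 (hφ k)

/-- Kolmogorov's backward equation, as a right derivative. -/
lemma hasDerivWithinAt_backward (hp : IsTransitionFunction q p) {i : ℕ}
    (hq : ∀ k, k ≠ i → 0 ≤ q i k) (hs : HasSum (q i) 0) {φ : ℕ → ℝ} (hφ : ∀ k, |φ k| ≤ 1)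
    {t : ℝ} (ht : 0 ≤ t) :
    HasDerivWithinAt (fun r => ∑' j, p r i j * φ j) (∑' k, q i k * ∑' j, p t k j * φ j)
      (Ioi t) t := by
  rw [hasDerivWithinAt_iff_tendsto_slope' self_notMem_Ioi]
  have h := hp.tendsto_generator hq hs (fun k => hp.abs_tsum_le ht k hφ)
  have hmap : Tendsto (fun r => r - t) (𝓝[>] t) (𝓝[>] 0) := by
    refine tendsto_nhdsWithin_iff.2 ⟨?_, ?_⟩
    · have : Tendsto (fun r => r - t) (𝓝 t) (𝓝 (t - t)) := (continuous_id.sub continuous_const).tendsto t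
      rw [sub_self] at this
      exact this.mono_left nhdsWithin_le_nhds
    · filter_upwards [self_mem_nhdsWithin] with r hr using sub_pos.2 (mem_Ioi.1 hr)
  refine (h.comp hmap).congr' ?_
  filter_upwards [self_mem_nhdsWithin] with r (hr : t < r)
  rw [Function.comp_apply, ← hp.tsum_semigroup (sub_pos.2 hr).le ht i hφ, slope_def_field,
    sub_add_cancel]

lemma abs_tsum_add_sub_le (hp : IsTransitionFunction q p) {h t : ℝ} (hh : 0 ≤ h) (ht : 0 ≤ t)
    (i : ℕ) {φ : ℕ → ℝ} (hφ : ∀ k, |φ k| ≤ 1) :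
    |∑' j, p (h + t) i j * φ j - ∑' j, p t i j * φ j| ≤ 2 * (1 - p h i i) := by
  rw [hp.tsum_semigroup hh ht i hφ]
  set ψ := fun k => ∑' j, p t k j * φ j with hψ
  have hψ1 : ∀ k, |ψ k| ≤ 1 := fun k => hp.abs_tsum_le ht k hφ
  have hS : HasSum (fun k => p h i k * (ψ k - ψ i)) (∑' k, p h i k * ψ k - ψ i) := by
    have := (hp.summable_mul hh i hψ1).hasSum.sub ((hp.hasSum_one h hh i).mul_right (ψ i))
    rw [one_mul] at this
    exact this.congr_fun fun k => by ring
  have hB : HasSum (fun k => (p h i k - if k = i then p h i i else 0) * 2)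
      (2 * (1 - p h i i)) := by
    have := ((hp.hasSum_one h hh i).sub (hasSum_ite_eq i (p h i i))).mul_right 2
    rwa [mul_comm] at this
  rw [← Real.norm_eq_abs]
  have := tsum_of_norm_bounded hB (f := fun k => p h i k * (ψ k - ψ i)) fun k => ?_
  · rwa [hS.tsum_eq] at this
  · by_cases hk : k = i
    · simp [hk]
    · have h0 := hp.nonneg h hh i k
      simp only [hk, if_false, sub_zero]
      rw [norm_mul, Real.norm_eq_abs, Real.norm_eq_abs, abs_of_nonneg h0]
      have : |ψ k - ψ i| ≤ 2 := (abs_sub _ _).trans (by linarith [hψ1 k, hψ1 i])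
      gcongr

lemma continuousOn_tsum (hp : IsTransitionFunction q p) (i : ℕ) {φ : ℕ → ℝ}
    (hφ : ∀ k, |φ k| ≤ 1) : ContinuousOn (fun t => ∑' j, p t i j * φ j) (Ici 0) := by
  intro t ht
  rw [ContinuousWithinAt, tendsto_iff_dist_tendsto_zero]
  have hlim : Tendsto (fun r => 2 * (1 - p (|r - t|) i i)) (𝓝[Ici 0] t) (𝓝 0) := by
    have h1 : Tendsto (fun h => p h i i) (𝓝[≥] 0) (𝓝 (p 0 i i)) :=
      (hp.rate i i).continuousWithinAt
    have h2 : Tendsto (fun r => |r - t|) (𝓝[Ici 0] t) (𝓝[≥] 0) := by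
      refine tendsto_nhdsWithin_iff.2 ⟨?_, Eventually.of_forall fun r => mem_Ici.2 (abs_nonneg _)⟩
      have : Tendsto (fun r => |r - t|) (𝓝 t) (𝓝 |t - t|) := by
        apply Continuous.tendsto; fun_prop
      rw [sub_self, abs_zero] at this
      exact this.mono_left nhdsWithin_le_nhds
    have h3 := (h1.comp h2).const_sub 1 |>.const_mul 2
    simpa [hp.zero] using h3
  refine squeeze_zero' (Eventually.of_forall fun _ => dist_nonneg) ?_ hlim
  filter_upwards [self_mem_nhdsWithin] with r (hr : 0 ≤ r)
  rw [Real.dist_eq]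
  rcases le_total t r with h | h
  · have := hp.abs_tsum_add_sub_le (sub_nonneg.2 h) ht i hφ
    rwa [sub_add_cancel, ← abs_of_nonneg (sub_nonneg.2 h)] at this
  · have := hp.abs_tsum_add_sub_le (sub_nonneg.2 h) hr i hφ
    rwa [sub_add_cancel, ← abs_of_nonneg (sub_nonneg.2 h), abs_sub_comm t r, abs_sub_comm] at this

end IsTransitionFunction
end Semigroup

/-! ### Uniqueness for the backward equation -/

/-- A maximum principle for the backward equation: bounded subsolutions with nonpositive initial
data stay nonpositive. The barrier is `η (1 + t) + (M + 1) (1 - σ ^ i)` with `σ` close to `1`; the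
generator applied to `1 - σ ^ i` is at most `-g(σ)` because `f ≥ 0`, and it exceeds the bound `M`
on `d` for all but finitely many `i`. -/
lemma backward_le_zero {a b : ℕ → ℝ} (ha : IsOffspring a) (hc : IsCritical a)
    (hbn : ∀ j, j ≠ 0 → 0 ≤ b j) (hb : HasSum b 0) {d : ℝ → ℕ → ℝ} {M : ℝ}
    (hM : ∀ t, 0 ≤ t → ∀ i, |d t i| ≤ M) (hcont : ∀ i, ContinuousOn (fun t => d t i) (Ici 0))
    (hderiv : ∀ t, 0 ≤ t → ∀ i,
      HasDerivWithinAt (fun r => d r i) (∑' k, rates a b i k * d t k) (Ioi t) t)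
    (h0 : ∀ i, d 0 i ≤ 0) {t : ℝ} (ht : 0 ≤ t) (i : ℕ) : d t i ≤ 0 := by
  have has := ha.hasSum_zero.summable
  have hbs := hb.summable
  have hM0 : 0 ≤ M := (abs_nonneg _).trans (hM 0 le_rfl 0)
  have hrs : ∀ i, HasSum (rates a b i) 0 := fun i => by
    have := hasSum_rates_mul_pow has hbs zero_le_one le_rfl i
    simpa [ha.gf_one_eq, gf_one b, hb.tsum_eq] using this
  have main : ∀ η : ℝ, 0 < η → ∀ σ : ℝ, 0 ≤ σ → σ < 1 → (M + 1) * (-gf b σ) < η →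
      d t i ≤ η * (1 + t) + (M + 1) * (1 - σ ^ i) := by
    intro η hη σ hσ0 hσ1 hσ
    set W : ℝ → ℕ → ℝ := fun r k => η * (1 + r) + (M + 1) * (1 - σ ^ k) with hW
    have hWlow : ∀ r, 0 ≤ r → ∀ k, 0 < W r k := fun r hr k => by
      have := pow_le_one₀ hσ0 hσ1.le (n := k)
      have h2 : 0 ≤ (M + 1) * (1 - σ ^ k) := mul_nonneg (by linarith) (by linarith)
      have h3 : 0 < η * (1 + r) := mul_pos hη (by linarith)
      simp only [hW]; linarith
    obtain ⟨N, hN⟩ : ∃ N, ∀ k, N ≤ k → ∀ r, 0 ≤ r → M < W r k := by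
      have hl : Tendsto (fun k => (M + 1) * (1 - σ ^ k)) atTop (𝓝 (M + 1)) := by
        have := ((tendsto_pow_atTop_nhds_zero_of_lt_one hσ0 hσ1).const_sub 1).const_mul (M + 1)
        simpa using this
      obtain ⟨N, hN⟩ := eventually_atTop.1 (hl.eventually (lt_mem_nhds (show M < M + 1 by linarith)))
      refine ⟨N, fun k hk r hr => ?_⟩
      have h3 : 0 < η * (1 + r) := mul_pos hη (by linarith)
      have := hN k hk
      simp only [hW]; linarith
    have hWgen : ∀ r k, HasSum (fun m => rates a b k m * W r m)
        ((M + 1) * (-(k * σ ^ (k - 1) * gf a σ + σ ^ k * gf b σ))) := fun r k => by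
      have h1 := (hrs k).mul_right (η * (1 + r) + (M + 1))
      have h2 := (hasSum_rates_mul_pow has hbs hσ0 hσ1.le k).mul_left (M + 1)
      have h3 := h1.sub h2
      rw [zero_mul, zero_sub, ← mul_neg] at h3
      exact h3.congr_fun fun m => by simp only [hW]; ring
    have hWgen_lt : ∀ k : ℕ,
        (M + 1) * (-(k * σ ^ (k - 1) * gf a σ + σ ^ k * gf b σ)) < η := fun k => by
      refine lt_of_le_of_lt ?_ hσ
      have h1 := ha.gf_nonneg hc hσ0 hσ1.le
      have h2 := neg_gf_nonneg hbn hb hσ0 hσ1.le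
      have h3 := pow_le_one₀ hσ0 hσ1.le (n := k)
      have h4 : 0 ≤ k * σ ^ (k - 1) * gf a σ := by positivity
      have h5 := mul_le_of_le_one_left h2 h3
      gcongr
      linarith
    have hclosed : IsClosed ({r | ∀ k, d r k - W r k ≤ 0} ∩ Icc 0 t) := by
      have : {r | ∀ k, d r k - W r k ≤ 0} ∩ Icc 0 t
          = ⋂ k, (Icc 0 t ∩ {r | d r k - W r k ≤ 0}) := by
        ext r
        simp only [mem_inter_iff, mem_ofPred_eq, mem_iInter]
        exact ⟨fun h k => ⟨h.2, h.1 k⟩, fun h => ⟨fun k => (h k).2, (h 0).1⟩⟩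
      rw [this]
      refine isClosed_iInter fun k => ?_
      have hck : ContinuousOn (fun r => d r k - W r k) (Icc 0 t) := by
        refine ((hcont k).mono Icc_subset_Ici_self).sub ?_
        simp only [hW]; fun_prop
      exact hck.preimage_isClosed_of_isClosed isClosed_Icc isClosed_Iic
    have hsub : Icc 0 t ⊆ {r | ∀ k, d r k - W r k ≤ 0} := by
      refine hclosed.Icc_subset_of_forall_mem_nhdsWithin ?_ ?_
      · intro k
        have := hWlow 0 le_rfl k
        linarith [h0 k]
      · rintro r ⟨hr, hr0, hrt⟩
        have hev : ∀ k ∈ Finset.range N, ∀ᶠ r' in 𝓝[>] r, d r' k - W r' k ≤ 0 := by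
          intro k _
          have hWd : HasDerivWithinAt (fun r => W r k) η (Ioi r) r := by
            have : HasDerivAt (fun r => W r k) η r := by
              have := (((hasDerivAt_id r).const_add 1).const_mul η).add_const
                ((M + 1) * (1 - σ ^ k))
              simpa [hW] using this
            exact this.hasDerivWithinAt
          have hd := (hderiv r hr0 k).sub hWd
          rcases (hr k).lt_or_eq with hlt | heq
          · have := hd.continuousWithinAt.eventually (gt_mem_nhds hlt)
            exact this.mono fun _ h => h.le
          · -- at a contact point the right derivative is negative
            have hsumd : Summable fun m => rates a b k m * d r m := by
              refine Summable.of_norm_bounded ((hrs k).summable.abs.mul_right M) fun m => ?_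
              rw [norm_mul]
              exact mul_le_mul_of_nonneg_left (hM r hr0 m) (abs_nonneg _)
            have hle : ∑' m, rates a b k m * d r m
                ≤ (M + 1) * (-(k * σ ^ (k - 1) * gf a σ + σ ^ k * gf b σ)) := by
              refine hasSum_le (fun m => ?_) hsumd.hasSum (hWgen r k)
              rcases eq_or_ne k m with rfl | hkm
              · rw [sub_eq_zero.1 heq]
              · exact mul_le_mul_of_nonneg_left (sub_nonpos.1 (hr m))
                  (rates_nonneg ha.nonneg hbn hkm)
            have hneg := lt_of_le_of_lt hle (hWgen_lt k)
            have hsl := (hasDerivWithinAt_iff_tendsto_slope' self_notMem_Ioi).1 hd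
            have := hsl.eventually (gt_mem_nhds (show _ < (0 : ℝ) by linarith))
            filter_upwards [this, self_mem_nhdsWithin] with r' h1 (h2 : r < r')
            rw [slope_def_field, div_neg_iff] at h1
            simp only [Pi.sub_apply] at h1
            rcases h1 with h1 | h1
            · linarith [h1.2]
            · linarith [h1.1]
        have hall := (Filter.eventually_all_finset (Finset.range N)).2 hev
        filter_upwards [hall, self_mem_nhdsWithin] with r' h1 (h2 : r < r') k
        rcases lt_or_ge k N with hk | hk
        · exact h1 k (Finset.mem_range.2 hk)
        · have h3 := hN k hk r' (by linarith)
          have h4 := (abs_le.1 (hM r' (by linarith) k)).2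
          linarith
    have := hsub ⟨ht, le_rfl⟩ i
    linarith
  -- let `σ → 1`, then `η → 0`
  have step : ∀ η : ℝ, 0 < η → d t i ≤ η * (1 + t) := by
    intro η hη
    have hne : (𝓝[Ioo (0 : ℝ) 1] 1).NeBot := by
      rw [nhdsWithin_Ioo_eq_nhdsLT one_pos]; infer_instance
    have hg : Tendsto (fun σ => (M + 1) * (-gf b σ)) (𝓝[Ioo 0 1] 1) (𝓝 0) := by
      have h1 : Tendsto (gf b) (𝓝[Ioo 0 1] 1) (𝓝 (gf b 1)) :=
        (continuousOn_gf hbs 1 (by simp)).mono_left (nhdsWithin_mono _ Ioo_subset_Icc_self)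
      rw [gf_one, hb.tsum_eq] at h1
      simpa using h1.neg.const_mul (M + 1)
    have hp : Tendsto (fun σ : ℝ => η * (1 + t) + (M + 1) * (1 - σ ^ i)) (𝓝[Ioo 0 1] 1)
        (𝓝 (η * (1 + t))) := by
      have : Tendsto (fun σ : ℝ => η * (1 + t) + (M + 1) * (1 - σ ^ i)) (𝓝 1)
        (𝓝 (η * (1 + t) + (M + 1) * (1 - 1 ^ i))) := by
        apply Continuous.tendsto; fun_prop
      rw [one_pow, sub_self, mul_zero, add_zero] at this
      exact this.mono_left nhdsWithin_le_nhds
    refine ge_of_tendsto hp ?_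
    filter_upwards [hg.eventually (gt_mem_nhds hη), self_mem_nhdsWithin] with σ h1 h2
    exact main η hη σ h2.1.le h2.2 h1
  have hlim : Tendsto (fun η : ℝ => η * (1 + t)) (𝓝[>] 0) (𝓝 0) := by
    have : Tendsto (fun η : ℝ => η * (1 + t)) (𝓝 0) (𝓝 (0 * (1 + t))) := by
      apply Continuous.tendsto; fun_prop
    rw [zero_mul] at this
    exact this.mono_left nhdsWithin_le_nhds
  refine ge_of_tendsto hlim ?_
  filter_upwards [self_mem_nhdsWithin] with η hη using step η hη

/-- Bounded solutions of the backward equation are determined by their initial data. -/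
lemma backward_unique {a b : ℕ → ℝ} (ha : IsOffspring a) (hc : IsCritical a)
    (hbn : ∀ j, j ≠ 0 → 0 ≤ b j) (hb : HasSum b 0) {u v : ℝ → ℕ → ℝ}
    (hu1 : ∀ t, 0 ≤ t → ∀ i, |u t i| ≤ 1) (hv1 : ∀ t, 0 ≤ t → ∀ i, |v t i| ≤ 1)
    (huc : ∀ i, ContinuousOn (fun t => u t i) (Ici 0))
    (hvc : ∀ i, ContinuousOn (fun t => v t i) (Ici 0))
    (hud : ∀ t, 0 ≤ t → ∀ i,
      HasDerivWithinAt (fun r => u r i) (∑' k, rates a b i k * u t k) (Ioi t) t)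
    (hvd : ∀ t, 0 ≤ t → ∀ i,
      HasDerivWithinAt (fun r => v r i) (∑' k, rates a b i k * v t k) (Ioi t) t)
    (h0 : ∀ i, u 0 i = v 0 i) {t : ℝ} (ht : 0 ≤ t) (i : ℕ) : u t i = v t i := by
  have hrs : ∀ i, Summable (rates a b i) := fun i => by
    have := hasSum_rates_mul_pow ha.hasSum_zero.summable hb.summable zero_le_one le_rfl i
    simpa using this.summable
  have hS : ∀ {w : ℕ → ℝ} (i : ℕ), (∀ k, |w k| ≤ 1) → Summable fun k => rates a b i k * w k := by
    intro w i hw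
    refine Summable.of_norm_bounded (hrs i).abs fun m => ?_
    rw [norm_mul]
    exact mul_le_of_le_one_right (abs_nonneg _) (hw m)
  have key : ∀ {u v : ℝ → ℕ → ℝ},
    (∀ t, 0 ≤ t → ∀ i, |u t i| ≤ 1) → (∀ t, 0 ≤ t → ∀ i, |v t i| ≤ 1) →
    (∀ i, ContinuousOn (fun t => u t i) (Ici 0)) →
    (∀ i, ContinuousOn (fun t => v t i) (Ici 0)) →
    (∀ t, 0 ≤ t → ∀ i,
      HasDerivWithinAt (fun r => u r i) (∑' k, rates a b i k * u t k) (Ioi t) t) →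
    (∀ t, 0 ≤ t → ∀ i,
      HasDerivWithinAt (fun r => v r i) (∑' k, rates a b i k * v t k) (Ioi t) t) →
    (∀ i, u 0 i = v 0 i) → u t i ≤ v t i := by
    intro u v hu1 hv1 huc hvc hud hvd h0
    have := backward_le_zero ha hc hbn hb (d := fun t i => u t i - v t i) (M := 2)
      (fun t ht i => (abs_sub _ _).trans (by linarith [hu1 t ht i, hv1 t ht i]))
      (fun i => (huc i).sub (hvc i)) (fun t ht i => ?_) (fun i => by simp [h0 i]) ht i
    · linarith
    · refine ((hud t ht i).sub (hvd t ht i)).congr_deriv ?_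
      rw [← (hS i (hu1 t ht)).tsum_sub (hS i (hv1 t ht))]
      exact tsum_congr fun k => by ring
  exact le_antisymm (key hu1 hv1 huc hvc hud hvd h0)
    (key hv1 hu1 hvc huc hvd hud fun i => (h0 i).symm)

/-! ### The flow of `f` -/

/-- The time `∫_0^x du / f(u)` the flow `x' = f(x)` takes from `0` to `x`. The function `f` is
extended to the left of `0` by the constant `f(0)`, so that `0` is not a boundary point. -/
noncomputable def flowTime (a : ℕ → ℝ) (x : ℝ) : ℝ := ∫ u in (0 : ℝ)..x, 1 / gf a (max u 0)

/-- The integral `∫_0^x g(u) / f(u) du`, with the same extension to the left of `0`. -/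
noncomputable def immigrationExp (a b : ℕ → ℝ) (x : ℝ) : ℝ :=
  ∫ u in (0 : ℝ)..x, gf b (max u 0) / gf a (max u 0)

lemma continuousOn_gf_max {c : ℕ → ℝ} (hc : Summable c) :
    ContinuousOn (fun u => gf c (max u 0)) (Iio 1) :=
  (continuousOn_gf hc).comp (by fun_prop) fun u (hu : u < 1) =>
    ⟨le_max_right _ _, max_le hu.le zero_le_one⟩

lemma hasDerivAt_integral_of_continuousOn {h : ℝ → ℝ} (hh : ContinuousOn h (Iio 1)) {x : ℝ}
    (hx : x < 1) : HasDerivAt (fun y => ∫ u in (0 : ℝ)..y, h u) (h x) x := by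
  refine intervalIntegral.integral_hasDerivAt_right ?_ ?_ (hh.continuousAt (Iio_mem_nhds hx))
  · refine (hh.mono fun u hu => ?_).intervalIntegrable
    exact lt_of_le_of_lt hu.2 (max_lt one_pos hx)
  · exact hh.stronglyMeasurableAtFilter isOpen_Iio x hx

section Flow
variable {a b : ℕ → ℝ}

lemma gf_max_pos (ha : IsOffspring a) (hc : IsCritical a) {x : ℝ} (hx : x < 1) :
    0 < gf a (max x 0) :=
  ha.gf_pos hc (le_max_right _ _) (max_lt hx one_pos)

lemma hasDerivAt_flowTime (ha : IsOffspring a) (hc : IsCritical a) {x : ℝ} (hx : x < 1) :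
    HasDerivAt (flowTime a) (1 / gf a (max x 0)) x :=
  hasDerivAt_integral_of_continuousOn (h := fun u => 1 / gf a (max u 0))
    (continuousOn_const.div (continuousOn_gf_max ha.hasSum_zero.summable)
      fun _ hu => (gf_max_pos ha hc hu).ne') hx

lemma hasDerivAt_immigrationExp (ha : IsOffspring a) (hc : IsCritical a) (hb : Summable b) {x : ℝ}
    (hx : x < 1) : HasDerivAt (immigrationExp a b) (gf b (max x 0) / gf a (max x 0)) x :=
  hasDerivAt_integral_of_continuousOn (h := fun u => gf b (max u 0) / gf a (max u 0))
    ((continuousOn_gf_max hb).div (continuousOn_gf_max ha.hasSum_zero.summable)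
      fun _ hu => (gf_max_pos ha hc hu).ne') hx

lemma flowTime_zero : flowTime a 0 = 0 := by simp [flowTime]

lemma flowTime_strictMonoOn (ha : IsOffspring a) (hc : IsCritical a) :
    StrictMonoOn (flowTime a) (Iio 1) := by
  refine strictMonoOn_of_deriv_pos (convex_Iio 1)
    (fun x hx => (hasDerivAt_flowTime ha hc hx).continuousAt.continuousWithinAt) fun x hx => ?_
  rw [interior_Iio] at hx
  rw [(hasDerivAt_flowTime ha hc hx).deriv]
  exact one_div_pos.2 (gf_max_pos ha hc hx)

/-- The flow never reaches `1`, because `f(s) ≤ |a_1| (1 - s)`. -/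
lemma neg_log_le_flowTime (ha : IsOffspring a) (hc : IsCritical a) {x : ℝ} (h0 : 0 ≤ x)
    (hx : x < 1) : -Real.log (1 - x) ≤ -a 1 * flowTime a x := by
  have hd : ∀ y < 1, HasDerivAt (fun y => -a 1 * flowTime a y + Real.log (1 - y))
      (-a 1 * (1 / gf a (max y 0)) + -1 / (1 - y)) y := fun y hy =>
    ((hasDerivAt_flowTime ha hc hy).const_mul (-a 1)).add
      (((hasDerivAt_id y).const_sub 1).log (by simp only [id]; linarith))
  have hm : MonotoneOn (fun y => -a 1 * flowTime a y + Real.log (1 - y)) (Ico 0 1) := by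
    refine monotoneOn_of_deriv_nonneg (convex_Ico 0 1)
      (fun y hy => (hd y hy.2).continuousAt.continuousWithinAt)
      (fun y hy => ?_) fun y hy => ?_
    · rw [interior_Ico] at hy
      exact (hd y hy.2).differentiableAt.differentiableWithinAt
    · rw [interior_Ico] at hy
      rw [(hd y hy.2).deriv, max_eq_left hy.1.le]
      have h1 := ha.gf_pos hc hy.1.le hy.2
      have h2 := ha.gf_le hy.1.le hy.2.le
      have h3 : 0 < 1 - y := by linarith [hy.2]
      have h4 : 1 / (1 - y) ≤ -a 1 * (1 / gf a y) := by
        rw [mul_one_div, div_le_div_iff₀ h3 h1]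
        linarith
      rw [neg_div]; linarith
  have := hm ⟨le_rfl, one_pos⟩ ⟨h0, hx⟩ h0
  simp only [flowTime_zero, mul_zero, sub_zero, Real.log_one, add_zero] at this
  linarith

lemma exists_flowTime_eq (ha : IsOffspring a) (hc : IsCritical a) (t : ℝ) :
    ∃ x < 1, flowTime a x = t := by
  rcases le_total t 0 with ht | ht
  · have ha0 := ha.zero_pos
    refine ⟨t * a 0, lt_of_le_of_lt (mul_nonpos_of_nonpos_of_nonneg ht ha0.le) one_pos, ?_⟩
    have : flowTime a (t * a 0) = ∫ _ in (0 : ℝ)..(t * a 0), 1 / a 0 := by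
      refine intervalIntegral.integral_congr fun u hu => ?_
      have hu0 : u ≤ 0 := by
        rw [uIcc_of_ge (mul_nonpos_of_nonpos_of_nonneg ht ha0.le)] at hu
        exact hu.2
      simp only [max_eq_right hu0, gf_zero]
    rw [this, intervalIntegral.integral_const, sub_zero, smul_eq_mul]
    field_simp
  · have hA : 0 < -a 1 := ha.zero_pos.trans ha.zero_lt
    set y := 1 - Real.exp (-(-a 1 * t)) with hy
    have hy1 : y < 1 := by linarith [Real.exp_pos (-(-a 1 * t))]
    have hy0 : 0 ≤ y := by
      have : Real.exp (-(-a 1 * t)) ≤ 1 := Real.exp_le_one_iff.2 (by nlinarith)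
      linarith
    have h1 := neg_log_le_flowTime ha hc hy0 hy1
    rw [hy, sub_sub_cancel, Real.log_exp, neg_neg, ← hy] at h1
    have h2 : t ≤ flowTime a y := le_of_mul_le_mul_left h1 hA
    have hcont : ContinuousOn (flowTime a) (Icc 0 y) := fun x hx =>
      (hasDerivAt_flowTime ha hc (hx.2.trans_lt hy1)).continuousAt.continuousWithinAt
    obtain ⟨x, hx, hxt⟩ := intermediate_value_Icc hy0 hcont
      (show t ∈ Icc (flowTime a 0) (flowTime a y) by rw [flowTime_zero]; exact ⟨ht, h2⟩)
    exact ⟨x, hx.2.trans_lt hy1, hxt⟩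

/-- The flow `x' = f(x)` started from `0`, the inverse of `flowTime`. -/
lemma exists_flow (ha : IsOffspring a) (hc : IsCritical a) :
    ∃ G : ℝ → ℝ, (∀ t, G t < 1) ∧ (∀ t, flowTime a (G t) = t) ∧
      (∀ x < 1, G (flowTime a x) = x) ∧ StrictMono G ∧
      ∀ t, HasDerivAt G (gf a (max (G t) 0)) t := by
  have hsm : StrictMono fun x : Iio (1 : ℝ) => flowTime a x := fun x y hxy =>
    flowTime_strictMonoOn ha hc x.2 y.2 hxy
  have hsurj : Function.Surjective fun x : Iio (1 : ℝ) => flowTime a x := fun t => by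
    obtain ⟨x, hx, hxt⟩ := exists_flowTime_eq ha hc t
    exact ⟨⟨x, hx⟩, hxt⟩
  set e := hsm.orderIsoOfSurjective _ hsurj with he
  have h1 : ∀ t, flowTime a (e.symm t) = t := fun t => e.apply_symm_apply t
  have hcont : Continuous fun t => (e.symm t : ℝ) :=
    continuous_subtype_val.comp e.symm.continuous
  refine ⟨fun t => e.symm t, fun t => (e.symm t).2, h1, fun x hx => ?_,
    fun s t hst => e.symm.strictMono hst, fun t => ?_⟩
  · exact congrArg Subtype.val (e.symm_apply_apply ⟨x, hx⟩)
  · have hpos := gf_max_pos ha hc (e.symm t).2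
    have := HasDerivAt.of_local_left_inverse (f := flowTime a) (g := fun t => (e.symm t : ℝ))
      hcont.continuousAt (hasDerivAt_flowTime ha hc (e.symm t).2) (one_div_pos.2 hpos).ne'
      (Eventually.of_forall h1)
    rwa [one_div, inv_inv] at this

lemma immigrationExp_antitoneOn (ha : IsOffspring a) (hc : IsCritical a)
    (hbn : ∀ j, j ≠ 0 → 0 ≤ b j) (hb : HasSum b 0) :
    AntitoneOn (immigrationExp a b) (Iio 1) := by
  refine antitoneOn_of_deriv_nonpos (convex_Iio 1)
    (fun x hx => (hasDerivAt_immigrationExp ha hc hb.summable hx).continuousAt.continuousWithinAt)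
    (fun x hx => ?_) fun x hx => ?_
  · rw [interior_Iio] at hx
    exact (hasDerivAt_immigrationExp ha hc hb.summable hx).differentiableAt.differentiableWithinAt
  · rw [interior_Iio] at hx
    rw [(hasDerivAt_immigrationExp ha hc hb.summable hx).deriv]
    have h1 := neg_gf_nonneg hbn hb (le_max_right x 0) (max_le (le_of_lt hx) zero_le_one)
    exact div_nonpos_of_nonpos_of_nonneg (by linarith) (gf_max_pos ha hc hx).le

/-! ### The generating functions of the transition probabilities -/

/-- The generating function of `p t k` is `G ^ k * exp (∫_s^G g / f)`, where `G` is the position at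
time `t` of the flow of `f` started from `s`: both sides are bounded solutions of the backward
equation with initial value `s ^ k`. -/
lemma gf_transition_eq (ha : IsOffspring a) (hc : IsCritical a) (hbn : ∀ j, j ≠ 0 → 0 ≤ b j)
    (hb : HasSum b 0) {p : ℝ → ℕ → ℕ → ℝ} (hp : IsMBPI a b p) {G : ℝ → ℝ} (hG1 : ∀ t, G t < 1)
    (hGinv : ∀ x < 1, G (flowTime a x) = x) (hGm : StrictMono G)
    (hGd : ∀ t, HasDerivAt G (gf a (max (G t) 0)) t) {t s : ℝ} (ht : 0 ≤ t) (hs0 : 0 ≤ s)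
    (hs1 : s < 1) (k : ℕ) :
    gf (p t k) s = G (flowTime a s + t) ^ k *
      Real.exp (immigrationExp a b (G (flowTime a s + t)) - immigrationExp a b s) := by
  have has := ha.hasSum_zero.summable
  have hp' : IsTransitionFunction (rates a b) p := hp
  have hrs : ∀ i, HasSum (rates a b i) 0 := fun i => by
    have := hasSum_rates_mul_pow has hb.summable zero_le_one le_rfl i
    simpa [ha.gf_one_eq, gf_one b, hb.tsum_eq] using this
  have hφ : ∀ k : ℕ, |s ^ k| ≤ 1 := fun k => by
    rw [abs_of_nonneg (pow_nonneg hs0 k)]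
    exact pow_le_one₀ hs0 hs1.le
  have hGs : ∀ t, 0 ≤ t → s ≤ G (flowTime a s + t) := fun t ht => by
    conv_lhs => rw [← hGinv s hs1]
    exact hGm.monotone (by linarith)
  have hd : ∀ t, 0 ≤ t → ∀ i : ℕ, HasDerivAt (fun r => G (flowTime a s + r) ^ i *
      Real.exp (immigrationExp a b (G (flowTime a s + r)) - immigrationExp a b s))
      (∑' k, rates a b i k * (G (flowTime a s + t) ^ k *
        Real.exp (immigrationExp a b (G (flowTime a s + t)) - immigrationExp a b s))) t := by
    intro t ht i
    have hx0 := hs0.trans (hGs t ht)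
    have hGd' := (hGd (flowTime a s + t)).comp_const_add (flowTime a s) t
    have hE := (((hasDerivAt_immigrationExp ha hc hb.summable (hG1 (flowTime a s + t))).comp t
      hGd').sub_const (immigrationExp a b s)).exp
    refine ((hGd'.pow i).mul hE).congr_deriv ?_
    have hsum := ((hasSum_rates_mul_pow has hb.summable hx0 (hG1 (flowTime a s + t)).le i).mul_right
      (Real.exp (immigrationExp a b (G (flowTime a s + t)) - immigrationExp a b s))).tsum_eq
    simp only [← mul_assoc]
    rw [hsum]
    have hpos := ha.gf_pos hc hx0 (hG1 (flowTime a s + t))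
    simp only [max_eq_left hx0, Function.comp_apply, Pi.pow_apply]
    field_simp
  refine backward_unique ha hc hbn hb (u := fun t k => gf (p t k) s)
    (v := fun t k => G (flowTime a s + t) ^ k *
      Real.exp (immigrationExp a b (G (flowTime a s + t)) - immigrationExp a b s))
    (fun t ht i => hp'.abs_tsum_le ht i hφ) (fun t ht i => ?_)
    (fun i => hp'.continuousOn_tsum i hφ)
    (fun i t ht => (hd t ht i).continuousAt.continuousWithinAt)
    (fun t ht i => hp'.hasDerivWithinAt_backward
      (fun k hk => rates_nonneg ha.nonneg hbn hk.symm) (hrs i) hφ ht)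
    (fun t ht i => (hd t ht i).hasDerivWithinAt) (fun i => ?_) ht k
  · have hx0 := hs0.trans (hGs t ht)
    have := immigrationExp_antitoneOn ha hc hbn hb hs1 (hG1 (flowTime a s + t)) (hGs t ht)
    rw [abs_of_nonneg (by positivity)]
    exact mul_le_one₀ (pow_le_one₀ hx0 (hG1 _).le) (Real.exp_pos _).le
      (Real.exp_le_one_iff.2 (by linarith))
  · simp only [add_zero, hGinv s hs1, sub_self, Real.exp_zero, mul_one]
    rw [gf, tsum_eq_single i]
    · simp [hp'.zero]
    · intro j hj
      simp [hp'.zero, hj.symm]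

/-- The properties of `F(t;s)`, `s ∈ [0,1)`, that the argument uses. -/
structure IsFlow (a : ℕ → ℝ) (Φ : ℝ → ℝ → ℝ) : Prop where
  le : ∀ t s, 0 ≤ t → 0 ≤ s → s < 1 → s ≤ Φ t s
  lt_one : ∀ t s, 0 ≤ t → 0 ≤ s → s < 1 → Φ t s < 1
  time : ∀ t s, 0 ≤ t → 0 ≤ s → s < 1 → flowTime a (Φ t s) = flowTime a s + t
  hasDerivAt : ∀ t s, 0 ≤ t → 0 < s → s < 1 →
    HasDerivAt (Φ t) (gf a (Φ t s) / gf a s) s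
  tendsto : Tendsto (fun t => Φ t 0) atTop (𝓝[<] 1)

lemma immigrationExp_no_immigration (x : ℝ) : immigrationExp a (fun _ => 0) x = 0 := by
  simp [immigrationExp, gf]

/-- `F(t;s)` is the flow of `f`. -/
lemma isFlow_F (ha : IsOffspring a) (hc : IsCritical a) {z : ℝ → ℕ → ℕ → ℝ} (hz : IsMBP a z) :
    IsFlow a (F z) ∧ (∀ t s, 0 ≤ t → 0 ≤ s → s < 1 → ∀ k, gf (z t k) s = F z t s ^ k) ∧
    ∀ (b : ℕ → ℝ) (p : ℝ → ℕ → ℕ → ℝ), (∀ j, j ≠ 0 → 0 ≤ b j) → HasSum b 0 → IsMBPI a b p →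
      ∀ t s, 0 ≤ t → 0 ≤ s → s < 1 → ∀ k, gf (p t k) s =
        F z t s ^ k * Real.exp (immigrationExp a b (F z t s) - immigrationExp a b s) := by
  obtain ⟨G, hG1, hGt, hGinv, hGm, hGd⟩ := exists_flow ha hc
  have hzk : ∀ t s, 0 ≤ t → 0 ≤ s → s < 1 → ∀ k, gf (z t k) s = G (flowTime a s + t) ^ k := by
    intro t s ht hs0 hs1 k
    have := gf_transition_eq ha hc (b := fun _ => 0) (fun _ _ => le_rfl) _root_.hasSum_zero hz hG1
      hGinv hGm hGd ht hs0 hs1 k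
    simpa [immigrationExp_no_immigration] using this
  have hF : ∀ t s, 0 ≤ t → 0 ≤ s → s < 1 → F z t s = G (flowTime a s + t) := by
    intro t s ht hs0 hs1
    simpa [F] using hzk t s ht hs0 hs1 1
  have hGs : ∀ t s, 0 ≤ t → s < 1 → s ≤ G (flowTime a s + t) := fun t s ht hs1 => by
    conv_lhs => rw [← hGinv s hs1]
    exact hGm.monotone (by linarith)
  refine ⟨⟨?_, ?_, ?_, ?_, ?_⟩, ?_, ?_⟩
  · intro t s ht hs0 hs1
    rw [hF t s ht hs0 hs1]
    exact hGs t s ht hs1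
  · intro t s ht hs0 hs1
    rw [hF t s ht hs0 hs1]
    exact hG1 _
  · intro t s ht hs0 hs1
    rw [hF t s ht hs0 hs1, hGt]
  · intro t s ht hs0 hs1
    have h1 : HasDerivAt (fun s => G (flowTime a s + t))
        (gf a (max (G (flowTime a s + t)) 0) * (1 / gf a (max s 0))) s :=
      (hGd (flowTime a s + t)).comp s ((hasDerivAt_flowTime ha hc hs1).add_const t)
    rw [max_eq_left hs0.le, max_eq_left (hs0.le.trans (hGs t s ht hs1)), mul_one_div,
      ← hF t s ht hs0.le hs1] at h1
    refine h1.congr_of_eventuallyEq ?_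
    filter_upwards [Ioo_mem_nhds hs0 hs1] with r hr using hF t r ht hr.1.le hr.2
  · refine tendsto_nhdsWithin_iff.2 ⟨?_, ?_⟩
    · rw [tendsto_order]
      refine ⟨fun x hx => ?_, fun x hx => ?_⟩
      · filter_upwards [eventually_gt_atTop (flowTime a x), eventually_ge_atTop 0] with t h1 h2
        rw [hF t 0 h2 le_rfl one_pos, flowTime_zero, zero_add, ← hGinv x hx]
        exact hGm h1
      · filter_upwards [eventually_ge_atTop 0] with t h2
        rw [hF t 0 h2 le_rfl one_pos]
        exact (hG1 _).trans hx
    · filter_upwards [eventually_ge_atTop 0] with t h2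
      rw [hF t 0 h2 le_rfl one_pos]
      exact hG1 _
  · intro t s ht hs0 hs1 k
    rw [hF t s ht hs0 hs1, hzk t s ht hs0 hs1]
  · intro b p hbn hb hp t s ht hs0 hs1 k
    rw [hF t s ht hs0 hs1]
    exact gf_transition_eq ha hc hbn hb hp hG1 hGinv hGm hGd ht hs0 hs1 k

end Flow

/-! ### Regular variation of `g` at `1` and the tail of the integral defining `π` -/

section Asymptotics
variable {a b : ℕ → ℝ} {ν δ : ℝ} {L ell : ℝ → ℝ}

/-- The error rate as a function of `x = F(t;0)`. -/
noncomputable def errAt (b : ℕ → ℝ) (κ x : ℝ) : ℝ := -gf b x / (1 - x) ^ κ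

lemma errAt_nonneg (hb : IsImmigration b) {κ x : ℝ} (h0 : 0 ≤ x) (h1 : x < 1) :
    0 ≤ errAt b κ x :=
  div_nonneg (neg_gf_nonneg hb.nonneg hb.hasSum_zero h0 h1.le)
    (Real.rpow_nonneg (by linarith) _)

lemma neg_gf_le_errAt (hb : IsImmigration b) {κ x : ℝ} (hκ : 0 ≤ κ) (h0 : 0 ≤ x) (h1 : x < 1) :
    -gf b x ≤ errAt b κ x := by
  have h := neg_gf_nonneg hb.nonneg hb.hasSum_zero h0 h1.le
  exact le_div_self h (Real.rpow_pos_of_pos (by linarith) _)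
    (Real.rpow_le_one (by linarith) (by linarith) hκ)

/-- One dyadic step of Potter's bound for `-g(1 - v) = v ^ δ * ℓ(1 / v)`. -/
lemma exists_neg_gf_half_le (hell : SlowlyVarying ell)
    (hg : ∀ s : ℝ, 0 ≤ s → s < 1 → gf b s = -((1 - s) ^ δ * ell (1 / (1 - s)))) {θ : ℝ}
    (hθ : θ < δ) : ∃ v₀, 0 < v₀ ∧ v₀ ≤ 1 ∧ ∀ v, 0 < v → v ≤ v₀ →
      -gf b (1 - 1 / 2 * v) ≤ (1 / 2) ^ θ * -gf b (1 - v) := by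
  obtain ⟨X, hX, -⟩ := hell.pos_measurable
  have h2 : (1 : ℝ) < 2 ^ (δ - θ) := Real.one_lt_rpow one_lt_two (by linarith)
  obtain ⟨Y, hY⟩ := eventually_atTop.1
    ((hell.tendsto 2 two_pos).eventually (gt_mem_nhds h2))
  set y₀ := max (max X Y) 1
  have hy₀ : 0 < y₀ := lt_of_lt_of_le one_pos (le_max_right _ _)
  refine ⟨1 / y₀, by positivity, (div_le_one hy₀).2 (le_max_right _ _), fun v hv hv0 => ?_⟩
  have hv1 : v ≤ 1 := hv0.trans ((div_le_one hy₀).2 (le_max_right _ _))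
  have hyv : y₀ ≤ 1 / v := by
    rw [le_div_iff₀ hv]
    rwa [le_div_iff₀ hy₀, mul_comm] at hv0
  have hpos := hX (1 / v) ((le_max_left _ _).trans ((le_max_left _ _).trans hyv))
  have h3 := hY (1 / v) ((le_max_right _ _).trans ((le_max_left _ _).trans hyv))
  rw [div_lt_iff₀ hpos] at h3
  rw [hg _ (by linarith) (by linarith), hg _ (by linarith) (by linarith), neg_neg, neg_neg,
    sub_sub_cancel, sub_sub_cancel, Real.mul_rpow (by norm_num) hv.le,
    show 1 / (1 / 2 * v) = 2 * (1 / v) by field_simp]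
  have hv3 : 0 < v ^ δ := Real.rpow_pos_of_pos hv _
  have h4 : (1 / 2 : ℝ) ^ δ * 2 ^ (δ - θ) = (1 / 2) ^ θ := by
    rw [one_div, Real.inv_rpow two_pos.le, Real.inv_rpow two_pos.le, ← Real.rpow_neg two_pos.le,
      ← Real.rpow_neg two_pos.le, ← Real.rpow_add two_pos]
    congr 1; ring
  calc (1 / 2 : ℝ) ^ δ * v ^ δ * ell (2 * (1 / v))
      ≤ (1 / 2) ^ δ * v ^ δ * (2 ^ (δ - θ) * ell (1 / v)) := by gcongr
    _ = (1 / 2 : ℝ) ^ δ * 2 ^ (δ - θ) * (v ^ δ * ell (1 / v)) := by ring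
    _ = _ := by rw [h4]

/-- Potter's bound for `-g`; monotonicity of `g` replaces uniform convergence. -/
lemma exists_neg_gf_le (hb : IsImmigration b) (hell : SlowlyVarying ell)
    (hg : ∀ s : ℝ, 0 ≤ s → s < 1 → gf b s = -((1 - s) ^ δ * ell (1 / (1 - s)))) {θ : ℝ}
    (hθ0 : 0 ≤ θ) (hθ : θ < δ) : ∃ u₀, 0 ≤ u₀ ∧ u₀ < 1 ∧ ∀ x y, u₀ ≤ x → x ≤ y → y < 1 →
      -gf b y ≤ 2 ^ θ * ((1 - y) / (1 - x)) ^ θ * -gf b x := by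
  obtain ⟨v₀, hv₀, hv₁, hstep⟩ := exists_neg_gf_half_le (b := b) hell hg hθ
  refine ⟨1 - v₀, by linarith, by linarith, fun x y hx hxy hy => ?_⟩
  have hx0 : 0 ≤ x := by linarith
  have hv : 0 < 1 - x := by linarith
  have hw : 0 < 1 - y := by linarith
  have hk := neg_gf_nonneg hb.nonneg hb.hasSum_zero hx0 (by linarith)
  have hit : ∀ n : ℕ, -gf b (1 - (1 / 2) ^ n * (1 - x)) ≤ ((1 / 2 : ℝ) ^ n) ^ θ * -gf b x := by
    intro n
    induction n with
    | zero => simp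
    | succ n ih =>
      have h1 : (1 / 2 : ℝ) ^ n ≤ 1 := pow_le_one₀ (by norm_num) (by norm_num)
      have h2 := hstep ((1 / 2) ^ n * (1 - x)) (by positivity) (by nlinarith)
      rw [pow_succ', Real.mul_rpow (by norm_num) (by positivity), mul_assoc, mul_assoc]
      exact h2.trans (by gcongr)
  obtain ⟨n, hn1, hn2⟩ := exists_nat_pow_near_of_lt_one (div_pos hw hv)
    ((div_le_one hv).2 (by linarith)) (show (0 : ℝ) < 1 / 2 by norm_num) (by norm_num)
  rw [div_le_iff₀ hv] at hn2
  have hmono : -gf b y ≤ -gf b (1 - (1 / 2) ^ n * (1 - x)) := by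
    have h1 : (1 / 2 : ℝ) ^ n ≤ 1 := pow_le_one₀ (by norm_num) (by norm_num)
    exact neg_gf_antitone hb.nonneg hb.hasSum_zero (by nlinarith) (by linarith) hy.le
  refine hmono.trans ((hit n).trans (mul_le_mul_of_nonneg_right ?_ hk))
  rw [← Real.mul_rpow two_pos.le (div_pos hw hv).le]
  refine Real.rpow_le_rpow (by positivity) ?_ hθ0
  rw [pow_succ] at hn1
  linarith

lemma continuousOn_piIntegrand (ha : IsOffspring a) (hc : IsCritical a) (hb : Summable b) :
    ContinuousOn (piIntegrand a b ν δ) (Ico 0 1) := by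
  refine ContinuousOn.add (((continuousOn_gf hb).mono Ico_subset_Icc_self).div
    ((continuousOn_gf ha.hasSum_zero.summable).mono Ico_subset_Icc_self)
    fun u hu => (ha.gf_pos hc hu.1 hu.2).ne') ?_
  refine continuousOn_const.div (ContinuousOn.rpow_const (by fun_prop) fun u hu => ?_)
    fun u hu => (Real.rpow_pos_of_pos (by linarith [hu.2]) _).ne'
  exact Or.inl (by linarith [hu.2])

lemma piIntegrand_one (ha : IsOffspring a) : piIntegrand a b ν δ 1 = 0 := by
  have : 1 + |δ - ν| ≠ 0 := by positivity
  simp [piIntegrand, ha.gf_one_eq, Real.zero_rpow this]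

/-- The hypothesis on `ℓ / L` says that the two singular terms of the integrand cancel up to a
factor `O(-g(u))`. -/
lemma exists_piIntegrand_le (hγ : δ - ν < 0)
    (hf : ∀ s : ℝ, 0 ≤ s → s < 1 → gf a s = (1 - s) ^ (1 + ν) * L (1 / (1 - s)))
    (hg : ∀ s : ℝ, 0 ≤ s → s < 1 → gf b s = -((1 - s) ^ δ * ell (1 / (1 - s))))
    (hb : IsImmigration b)
    (hCL : (fun x => ell x / L x - |δ - ν|) =O[atTop] (fun x => ell x / x ^ δ)) :
    ∃ C u₀, 0 < C ∧ 0 ≤ u₀ ∧ u₀ < 1 ∧ ∀ u, u₀ ≤ u → u < 1 →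
      |piIntegrand a b ν δ u| ≤ C * -gf b u / (1 - u) ^ (1 + |δ - ν|) := by
  obtain ⟨C, hC, hCL⟩ := hCL.exists_pos
  obtain ⟨X, hX⟩ := eventually_atTop.1 hCL.bound
  have hX1 : 0 < max X 1 := lt_of_lt_of_le one_pos (le_max_right _ _)
  refine ⟨C, 1 - 1 / max X 1, hC, ?_, by linarith [one_div_pos.2 hX1], fun u hu hu1 => ?_⟩
  · rw [sub_nonneg, div_le_one hX1]; exact le_max_right _ _
  have hu0 : 0 ≤ u := le_trans (by rw [sub_nonneg, div_le_one hX1]; exact le_max_right _ _) hu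
  have hv : 0 < 1 - u := by linarith
  have hx : X ≤ 1 / (1 - u) := by
    refine (le_max_left X 1).trans ?_
    rw [le_div_iff₀ hv, mul_comm, ← le_div_iff₀ hX1]
    linarith
  have h := hX _ hx
  have hgu := hg u hu0 hu1
  have hk := neg_gf_nonneg hb.nonneg hb.hasSum_zero hu0 hu1.le
  have hk2 : ell (1 / (1 - u)) / (1 / (1 - u)) ^ δ = -gf b u := by
    rw [hgu, neg_neg, one_div (1 - u), Real.inv_rpow hv.le, div_inv_eq_mul, mul_comm]
  rw [hk2, Real.norm_of_nonneg hk, Real.norm_eq_abs] at h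
  have hden : 0 < (1 - u) ^ (1 + |δ - ν|) := Real.rpow_pos_of_pos hv _
  have hpow : (1 - u) ^ (1 + ν) = (1 - u) ^ δ * (1 - u) ^ (1 + |δ - ν|) := by
    rw [← Real.rpow_add hv, abs_of_neg hγ]; congr 1; ring
  have hδ : 0 < (1 - u) ^ δ := Real.rpow_pos_of_pos hv _
  have heq : piIntegrand a b ν δ u
      = -(ell (1 / (1 - u)) / L (1 / (1 - u)) - |δ - ν|) / (1 - u) ^ (1 + |δ - ν|) := by
    unfold piIntegrand
    have : gf b u / gf a u
        = -(ell (1 / (1 - u)) / L (1 / (1 - u))) / (1 - u) ^ (1 + |δ - ν|) := by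
      rw [hgu, hf u hu0 hu1, hpow, neg_div, neg_div, mul_assoc, mul_div_mul_left _ _ hδ.ne',
        div_div, mul_comm (L _)]
    rw [this]
    ring
  rw [heq, abs_div, abs_neg, abs_of_pos hden]
  gcongr

lemma integral_one_sub_rpow {r : ℝ} (hr : -1 < r) {y : ℝ} :
    ∫ u in y..1, (1 - u) ^ r = (1 - y) ^ (r + 1) / (r + 1) := by
  rw [intervalIntegral.integral_comp_sub_left (fun v : ℝ => v ^ r) 1, sub_self,
    integral_rpow (Or.inl hr), Real.zero_rpow (by linarith), sub_zero]

lemma intervalIntegrable_one_sub_rpow {r : ℝ} (hr : -1 < r) {y : ℝ} :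
    IntervalIntegrable (fun u : ℝ => (1 - u) ^ r) volume y 1 := by
  have h := (intervalIntegral.intervalIntegrable_rpow' hr (a := 0) (b := 1 - y)).comp_sub_left 1
  simp only [sub_zero, sub_sub_cancel] at h
  exact h.symm

/-- Domination of the integrand on `[x, 1]` by an integrable power, with a constant of the order
of `-g(x)`. -/
lemma exists_piIntegrand_le_rpow (ha : IsOffspring a) (hb : IsImmigration b) (hγ : δ - ν < 0)
    (hμ : 0 < 2 * δ - ν) (hell : SlowlyVarying ell)
    (hf : ∀ s : ℝ, 0 ≤ s → s < 1 → gf a s = (1 - s) ^ (1 + ν) * L (1 / (1 - s)))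
    (hg : ∀ s : ℝ, 0 ≤ s → s < 1 → gf b s = -((1 - s) ^ δ * ell (1 / (1 - s))))
    (hCL : (fun x => ell x / L x - |δ - ν|) =O[atTop] (fun x => ell x / x ^ δ)) :
    ∃ C u₀ θ, 0 < C ∧ 0 ≤ u₀ ∧ u₀ < 1 ∧ |δ - ν| < θ ∧
      (∀ u, u₀ ≤ u → u < 1 → |piIntegrand a b ν δ u| ≤ C * -gf b u / (1 - u) ^ (1 + |δ - ν|)) ∧
      (∀ x, u₀ ≤ x → x < 1 → errAt b |δ - ν| x ≤ C * (1 - x) ^ (θ - |δ - ν|)) ∧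
      (∀ x u, u₀ ≤ x → x ≤ u → u ≤ 1 → |piIntegrand a b ν δ u|
        ≤ C * -gf b x / (1 - x) ^ θ * (1 - u) ^ (θ - |δ - ν| - 1)) := by
  obtain ⟨C, u₀, hC, hu0, hu1, hpi⟩ := exists_piIntegrand_le hγ hf hg hb hCL
  have hκ : |δ - ν| = ν - δ := by rw [abs_of_neg hγ]; ring
  have hκ0 : 0 < |δ - ν| := by rw [hκ]; linarith
  obtain ⟨θ, hθ1, hθ2⟩ := exists_between (show |δ - ν| < δ by rw [hκ]; linarith)
  have hθ0 : 0 < θ := hκ0.trans hθ1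
  obtain ⟨w₀, hw0, hw1, hpot⟩ := exists_neg_gf_le hb hell hg hθ0.le hθ2
  have hm1 : max u₀ w₀ < 1 := max_lt hu1 hw1
  have hm0 : 0 ≤ max u₀ w₀ := hu0.trans (le_max_left _ _)
  set m := max u₀ w₀ with hm
  have hkm := neg_gf_nonneg hb.nonneg hb.hasSum_zero hm0 hm1.le
  have h2θ : (0 : ℝ) < 2 ^ θ := Real.rpow_pos_of_pos two_pos _
  have hmθ : 0 < (1 - m) ^ θ := Real.rpow_pos_of_pos (by linarith) _
  have hC' : 0 ≤ 2 ^ θ * -gf b m / (1 - m) ^ θ := by positivity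
  refine ⟨C + C * 2 ^ θ + 2 ^ θ * -gf b m / (1 - m) ^ θ, m, θ, by positivity, hm0, hm1,
    hθ1, ?_, ?_, ?_⟩
  · intro u hmu hu
    refine (hpi u ((le_max_left _ _).trans hmu) hu).trans ?_
    have := neg_gf_nonneg hb.nonneg hb.hasSum_zero (hm0.trans hmu) hu.le
    have hv : 0 < (1 - u) ^ (1 + |δ - ν|) := Real.rpow_pos_of_pos (by linarith) _
    gcongr
    have : 0 < C * 2 ^ θ := by positivity
    linarith
  · intro x hmx hx
    have hv : 0 < 1 - x := by linarith
    have h := hpot m x (le_max_right _ _) hmx hx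
    rw [errAt, Real.rpow_sub hv, ← mul_div_assoc]
    refine div_le_div_of_nonneg_right (h.trans ?_) (Real.rpow_nonneg hv.le _)
    rw [Real.div_rpow hv.le (by linarith)]
    have hxθ : 0 < (1 - x) ^ θ := Real.rpow_pos_of_pos hv _
    calc 2 ^ θ * ((1 - x) ^ θ / (1 - m) ^ θ) * -gf b m
        = 2 ^ θ * -gf b m / (1 - m) ^ θ * (1 - x) ^ θ := by ring
      _ ≤ _ := by
        gcongr
        have : 0 < C * 2 ^ θ := by positivity
        linarith
  · intro x u hmx hxu hu
    have hx0 : 0 ≤ x := hm0.trans hmx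
    have hkx := neg_gf_nonneg hb.nonneg hb.hasSum_zero hx0 (hxu.trans hu)
    rcases hu.lt_or_eq with hu | rfl
    · have hv : 0 < 1 - u := by linarith
      have hw : 0 < 1 - x := by linarith
      have hwθ : 0 < (1 - x) ^ θ := Real.rpow_pos_of_pos hw _
      have hvr : 0 < (1 - u) ^ (θ - |δ - ν| - 1) := Real.rpow_pos_of_pos hv _
      refine (hpi u ((le_max_left _ _).trans (hmx.trans hxu)) hu).trans ?_
      have h := hpot x u ((le_max_right _ _).trans hmx) hxu hu
      rw [Real.div_rpow hv.le hw.le] at h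
      have hpow : (1 - u) ^ θ / (1 - u) ^ (1 + |δ - ν|) = (1 - u) ^ (θ - |δ - ν| - 1) := by
        rw [← Real.rpow_sub hv]; congr 1; ring
      calc C * -gf b u / (1 - u) ^ (1 + |δ - ν|)
          ≤ C * (2 ^ θ * ((1 - u) ^ θ / (1 - x) ^ θ) * -gf b x) / (1 - u) ^ (1 + |δ - ν|) := by
            gcongr
        _ = C * 2 ^ θ * -gf b x / (1 - x) ^ θ * ((1 - u) ^ θ / (1 - u) ^ (1 + |δ - ν|)) := by
            ring
        _ ≤ _ := by
            rw [hpow]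
            gcongr
            linarith
    · rw [piIntegrand_one ha, abs_zero]
      have hw : 0 ≤ 1 - x := by linarith
      positivity

lemma intervalIntegrable_piIntegrand (ha : IsOffspring a) (hc : IsCritical a)
    (hb : IsImmigration b) (hγ : δ - ν < 0) (hμ : 0 < 2 * δ - ν) (hell : SlowlyVarying ell)
    (hf : ∀ s : ℝ, 0 ≤ s → s < 1 → gf a s = (1 - s) ^ (1 + ν) * L (1 / (1 - s)))
    (hg : ∀ s : ℝ, 0 ≤ s → s < 1 → gf b s = -((1 - s) ^ δ * ell (1 / (1 - s))))
    (hCL : (fun x => ell x / L x - |δ - ν|) =O[atTop] (fun x => ell x / x ^ δ)) {s : ℝ}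
    (hs0 : 0 ≤ s) (hs1 : s < 1) : IntervalIntegrable (piIntegrand a b ν δ) volume s 1 := by
  obtain ⟨C, u₀, θ, hC, hu0, hu1, hθ, -, -, hdom⟩ :=
    exists_piIntegrand_le_rpow ha hb hγ hμ hell hf hg hCL
  have hcont := continuousOn_piIntegrand (ν := ν) (δ := δ) ha hc hb.hasSum_zero.summable
  have hm1 : max s u₀ < 1 := max_lt hs1 hu1
  refine IntervalIntegrable.trans (b := max s u₀) ?_ ?_
  · refine (hcont.mono ?_).intervalIntegrable
    rw [uIcc_of_le (le_max_left _ _)]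
    exact fun u hu => ⟨hs0.trans hu.1, hu.2.trans_lt hm1⟩
  · have hdI := (intervalIntegrable_one_sub_rpow (r := θ - |δ - ν| - 1) (by linarith)
      (y := max s u₀)).const_mul (C * -gf b u₀ / (1 - u₀) ^ θ)
    rw [intervalIntegrable_iff_integrableOn_Ioo_of_le hm1.le] at hdI ⊢
    refine Integrable.mono' hdI ?_ ?_
    · refine ContinuousOn.aestronglyMeasurable (hcont.mono fun u hu => ?_) measurableSet_Ioo
      exact ⟨hs0.trans ((le_max_left _ _).trans hu.1.le), hu.2⟩
    · filter_upwards [ae_restrict_mem measurableSet_Ioo] with u hu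
      exact hdom u₀ u le_rfl ((le_max_right _ _).trans hu.1.le) hu.2.le

lemma hasDerivAt_one_div_one_sub_rpow (κ : ℝ) {u : ℝ} (hu : u < 1) :
    HasDerivAt (fun u : ℝ => 1 / (1 - u) ^ κ) (κ / (1 - u) ^ (1 + κ)) u := by
  have hv : 0 < 1 - u := by linarith
  have h := ((hasDerivAt_id u).const_sub 1).rpow_const (p := -κ) (Or.inl hv.ne')
  have heq : (fun u : ℝ => 1 / (1 - u) ^ κ) =ᶠ[𝓝 u] fun y => (1 - id y) ^ (-κ) := by
    filter_upwards [Iio_mem_nhds hu] with y (hy : y < 1)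
    rw [id, Real.rpow_neg (by linarith), one_div]
  refine (h.congr_of_eventuallyEq heq).congr_deriv ?_
  rw [id, show -κ - 1 = -(1 + κ) by ring, Real.rpow_neg hv.le]
  ring

/-- `π(s) = π(y) exp (∫_s^y g / f)`. -/
lemma limitPi_eq_mul_exp (ha : IsOffspring a) (hc : IsCritical a) (hb : Summable b)
    (hint : ∀ s : ℝ, 0 ≤ s → s < 1 → IntervalIntegrable (piIntegrand a b ν δ) volume s 1)
    {s y : ℝ} (hs0 : 0 ≤ s) (hsy : s ≤ y) (hy : y < 1) :
    limitPi a b ν δ s = limitPi a b ν δ y *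
      Real.exp (immigrationExp a b y - immigrationExp a b s) := by
  have h1 : ∫ u in s..y, piIntegrand a b ν δ u = (immigrationExp a b y + 1 / (1 - y) ^ |δ - ν|)
      - (immigrationExp a b s + 1 / (1 - s) ^ |δ - ν|) := by
    refine intervalIntegral.integral_eq_sub_of_hasDerivAt
      (f := fun u => immigrationExp a b u + 1 / (1 - u) ^ |δ - ν|) (fun u hu => ?_) ?_
    · rw [uIcc_of_le hsy] at hu
      have hu1 : u < 1 := hu.2.trans_lt hy
      have h := (hasDerivAt_immigrationExp ha hc hb hu1).add
        (hasDerivAt_one_div_one_sub_rpow |δ - ν| hu1)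
      rwa [max_eq_left (hs0.trans hu.1)] at h
    · refine (hint s hs0 (hsy.trans_lt hy)).mono_set ?_
      rw [uIcc_of_le hsy, uIcc_of_le (hsy.trans hy.le)]
      exact Icc_subset_Icc_right hy.le
  have hsplit := intervalIntegral.integral_add_adjacent_intervals
    (μ := volume) (f := piIntegrand a b ν δ) (a := s) (b := y) (c := 1)
    ((hint s hs0 (hsy.trans_lt hy)).mono_set (by
      rw [uIcc_of_le hsy, uIcc_of_le (hsy.trans hy.le)]
      exact Icc_subset_Icc_right hy.le)) (hint y (hs0.trans hsy) hy)
  unfold limitPi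
  rw [← Real.exp_add, ← hsplit, h1]
  congr 1
  ring

lemma limitPi_pos (s : ℝ) : 0 < limitPi a b ν δ s := Real.exp_pos _

/-- If the flow takes time `t` from `x` to `y`, then `log π(y)` differs from `(1 - x) ^ (-|γ|)` by
`O((1 + t) * errAt x)`. The integral over `[y, 1]` is bounded by Karamata's theorem, and the
increment of `(1 - u) ^ (-|γ|)` between `x` and `y` is at most `2 * (-g(x)) * t` because
`|γ| (1 - u) ^ (-1 - |γ|) ≤ 2 * (-g(u)) / f(u)` near `1`. -/
lemma exists_log_limitPi_sub_le (ha : IsOffspring a) (hc : IsCritical a) (hb : IsImmigration b)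
    (hγ : δ - ν < 0) (hμ : 0 < 2 * δ - ν) (hell : SlowlyVarying ell)
    (hf : ∀ s : ℝ, 0 ≤ s → s < 1 → gf a s = (1 - s) ^ (1 + ν) * L (1 / (1 - s)))
    (hg : ∀ s : ℝ, 0 ≤ s → s < 1 → gf b s = -((1 - s) ^ δ * ell (1 / (1 - s))))
    (hCL : (fun x => ell x / L x - |δ - ν|) =O[atTop] (fun x => ell x / x ^ δ)) :
    ∃ C u₀, 0 < C ∧ 0 ≤ u₀ ∧ u₀ < 1 ∧ ∀ x y, u₀ ≤ x → x ≤ y → y < 1 →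
      |1 / (1 - x) ^ |δ - ν| - (1 / (1 - y) ^ |δ - ν| + ∫ u in y..1, piIntegrand a b ν δ u)|
        ≤ C * (1 + (flowTime a y - flowTime a x)) * errAt b |δ - ν| x := by
  obtain ⟨C, u₀, θ, hC, hu0, hu1, hθ, hpi, -, hdom⟩ :=
    exists_piIntegrand_le_rpow ha hb hγ hμ hell hf hg hCL
  have hκ0 : 0 < |δ - ν| := abs_pos.2 hγ.ne
  -- make `C * (-g(u)) ≤ |γ| / 2` near `1`
  obtain ⟨u₁, hu₁, hk₁⟩ : ∃ u₁ < (1 : ℝ), ∀ u, u₁ ≤ u → 0 ≤ u → u < 1 →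
      C * -gf b u ≤ |δ - ν| / 2 := by
    have h1 : Tendsto (fun u => C * -gf b u) (𝓝[Icc 0 1] 1) (𝓝 (C * -gf b 1)) :=
      ((continuousOn_gf hb.hasSum_zero.summable 1 (by simp)).neg).const_mul C
    rw [gf_one, hb.hasSum_zero.tsum_eq, neg_zero, mul_zero] at h1
    have h2 := h1.eventually (gt_mem_nhds (half_pos hκ0))
    rw [eventually_nhdsWithin_iff] at h2
    obtain ⟨e, he, h3⟩ := Metric.eventually_nhds_iff.1 h2
    refine ⟨1 - e / 2, by linarith, fun u hu h0 hu1 => (h3 ?_ ⟨h0, hu1.le⟩).le⟩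
    rw [Real.dist_eq, abs_lt]
    constructor <;> linarith
  have hm0 : 0 ≤ max u₀ u₁ := hu0.trans (le_max_left _ _)
  have hr : 0 < θ - |δ - ν| := by linarith
  refine ⟨2 + C / (θ - |δ - ν|), max u₀ u₁, by positivity, hm0, max_lt hu1 hu₁,
    fun x y hx hxy hy => ?_⟩
  have hx0 : 0 ≤ x := hm0.trans hx
  have hx1 : x < 1 := hxy.trans_lt hy
  have hxu : u₀ ≤ x := (le_max_left _ _).trans hx
  have hkx := neg_gf_nonneg hb.nonneg hb.hasSum_zero hx0 hx1.le
  have hv : 0 < 1 - x := by linarith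
  have hw : 0 < 1 - y := by linarith
  have hE := errAt_nonneg hb (κ := |δ - ν|) hx0 hx1
  have hkE := neg_gf_le_errAt hb hκ0.le hx0 hx1
  have hft : 0 ≤ flowTime a y - flowTime a x :=
    sub_nonneg.2 ((flowTime_strictMonoOn ha hc).monotoneOn hx1 hy hxy)
  have hint : |∫ u in y..1, piIntegrand a b ν δ u|
      ≤ C / (θ - |δ - ν|) * errAt b |δ - ν| x := by
    have h := intervalIntegral.norm_integral_le_of_norm_le (f := piIntegrand a b ν δ) hy.le
      (Eventually.of_forall fun u hu => hdom x u hxu (hxy.trans (le_of_lt hu.1)) hu.2)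
      ((intervalIntegrable_one_sub_rpow (r := θ - |δ - ν| - 1) (by linarith)
        (y := y)).const_mul _)
    rw [intervalIntegral.integral_const_mul, integral_one_sub_rpow (by linarith),
      sub_add_cancel] at h
    refine h.trans ?_
    have h1 : (1 - y) ^ (θ - |δ - ν|) ≤ (1 - x) ^ (θ - |δ - ν|) :=
      Real.rpow_le_rpow hw.le (by linarith) hr.le
    have hxθ : 0 < (1 - x) ^ θ := Real.rpow_pos_of_pos hv _
    calc C * -gf b x / (1 - x) ^ θ * ((1 - y) ^ (θ - |δ - ν|) / (θ - |δ - ν|))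
        ≤ C * -gf b x / (1 - x) ^ θ * ((1 - x) ^ (θ - |δ - ν|) / (θ - |δ - ν|)) := by
          gcongr
      _ = C / (θ - |δ - ν|) * errAt b |δ - ν| x := by
          rw [errAt, Real.rpow_sub hv]
          field_simp
  have hinc0 : 1 / (1 - x) ^ |δ - ν| ≤ 1 / (1 - y) ^ |δ - ν| := by
    refine one_div_le_one_div_of_le (Real.rpow_pos_of_pos hw _) ?_
    exact Real.rpow_le_rpow hw.le (by linarith) hκ0.le
  have hinc : 1 / (1 - y) ^ |δ - ν| - 1 / (1 - x) ^ |δ - ν|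
      ≤ 2 * -gf b x * (flowTime a y - flowTime a x) := by
    have hd : ∀ u < 1, HasDerivAt
        (fun u => 2 * -gf b x * flowTime a u - 1 / (1 - u) ^ |δ - ν|)
        (2 * -gf b x * (1 / gf a (max u 0)) - |δ - ν| / (1 - u) ^ (1 + |δ - ν|)) u :=
      fun u hu => ((hasDerivAt_flowTime ha hc hu).const_mul _).sub
        (hasDerivAt_one_div_one_sub_rpow _ hu)
    have hm : MonotoneOn (fun u => 2 * -gf b x * flowTime a u - 1 / (1 - u) ^ |δ - ν|)
        (Ico x 1) := by
      refine monotoneOn_of_deriv_nonneg (convex_Ico x 1)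
        (fun u hu => (hd u hu.2).continuousAt.continuousWithinAt)
        (fun u hu => ?_) fun u hu => ?_
      · rw [interior_Ico] at hu
        exact (hd u hu.2).differentiableAt.differentiableWithinAt
      · rw [interior_Ico] at hu
        have hu0' : 0 ≤ u := hx0.trans hu.1.le
        have hfu := ha.gf_pos hc hu0' hu.2
        have hkmono := neg_gf_antitone hb.nonneg hb.hasSum_zero hx0 hu.1.le hu.2.le
        have hpu := hpi u (hxu.trans hu.1.le) hu.2
        have hku := hk₁ u ((le_max_right _ _).trans (hx.trans hu.1.le)) hu0' hu.2
        have hden : 0 < (1 - u) ^ (1 + |δ - ν|) := Real.rpow_pos_of_pos (by linarith [hu.2]) _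
        rw [(hd u hu.2).deriv, max_eq_left hu0']
        have h1 : C * -gf b u / (1 - u) ^ (1 + |δ - ν|)
            ≤ |δ - ν| / 2 / (1 - u) ^ (1 + |δ - ν|) := by gcongr
        have h2 := (le_abs_self _).trans (hpu.trans h1)
        unfold piIntegrand at h2
        have h3 : -gf b u / gf a u ≤ -gf b x * (1 / gf a u) := by
          rw [mul_one_div]; gcongr
        rw [neg_div] at h3
        rw [div_right_comm] at h2
        linarith
    have := hm ⟨le_rfl, hx1⟩ ⟨hxy, hy⟩ hxy
    simp only at this
    linarith
  have h2 : 2 * -gf b x * (flowTime a y - flowTime a x)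
      ≤ 2 * errAt b |δ - ν| x * (flowTime a y - flowTime a x) := by gcongr
  have h4 : 0 ≤ C / (θ - |δ - ν|) * (flowTime a y - flowTime a x) * errAt b |δ - ν| x := by
    positivity
  have h5 := abs_le.1 hint
  rw [abs_le]
  constructor <;> nlinarith [h5.1, h5.2]

/-- The error rate tends to `0`. -/
lemma tendsto_errAt (ha : IsOffspring a) (hb : IsImmigration b)
    (hγ : δ - ν < 0) (hμ : 0 < 2 * δ - ν) (hell : SlowlyVarying ell)
    (hf : ∀ s : ℝ, 0 ≤ s → s < 1 → gf a s = (1 - s) ^ (1 + ν) * L (1 / (1 - s)))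
    (hg : ∀ s : ℝ, 0 ≤ s → s < 1 → gf b s = -((1 - s) ^ δ * ell (1 / (1 - s))))
    (hCL : (fun x => ell x / L x - |δ - ν|) =O[atTop] (fun x => ell x / x ^ δ)) :
    Tendsto (errAt b |δ - ν|) (𝓝[<] 1) (𝓝 0) := by
  obtain ⟨C, u₀, θ, hC, hu0, hu1, hθ, -, hE, -⟩ :=
    exists_piIntegrand_le_rpow ha hb hγ hμ hell hf hg hCL
  have hr : 0 < θ - |δ - ν| := by linarith
  have hlim : Tendsto (fun x : ℝ => C * (1 - x) ^ (θ - |δ - ν|)) (𝓝[<] 1) (𝓝 0) := by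
    have h1 : Tendsto (fun x : ℝ => C * (1 - x) ^ (θ - |δ - ν|)) (𝓝 1)
        (𝓝 (C * (1 - 1) ^ (θ - |δ - ν|))) := by
      refine Tendsto.const_mul C (Tendsto.rpow_const ?_ (Or.inr hr.le))
      exact tendsto_const_nhds.sub tendsto_id
    rw [sub_self, Real.zero_rpow hr.ne', mul_zero] at h1
    exact h1.mono_left nhdsWithin_le_nhds
  refine squeeze_zero' ?_ ?_ hlim
  · filter_upwards [Ioo_mem_nhdsLT hu1] with x hx
    exact errAt_nonneg hb (hu0.trans hx.1.le) hx.2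
  · filter_upwards [Ioo_mem_nhdsLT hu1] with x hx using hE x hx.1.le hx.2

end Asymptotics

/-! ### Convergence of the generating functions -/

section Main
variable {a b : ℕ → ℝ} {ν δ : ℝ} {L ell : ℝ → ℝ} {p z : ℝ → ℕ → ℕ → ℝ}

lemma F_zero_mem (ha : IsOffspring a) (hc : IsCritical a) (hz : IsMBP a z) {t : ℝ} (ht : 0 ≤ t) :
    0 ≤ F z t 0 ∧ F z t 0 < 1 :=
  have h := (isFlow_F ha hc hz).1
  ⟨h.le t 0 ht le_rfl one_pos, h.lt_one t 0 ht le_rfl one_pos⟩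

lemma tau_eq {t : ℝ} (ht : 0 < t) (hν : 0 < ν) : tau ν z t = 1 / (1 - F z t 0) := by
  have : 0 < (ν * t) ^ (1 / ν) := Real.rpow_pos_of_pos (mul_pos hν ht) _
  rw [tau, scaleN]
  nth_rw 1 [← mul_one ((ν * t) ^ (1 / ν))]
  rw [mul_div_mul_left _ _ this.ne']

lemma bigT_eq {t : ℝ} (ht : 0 < t) (hν : 0 < ν) (hF : F z t 0 < 1) :
    bigT ν δ z t = 1 / (1 - F z t 0) ^ |δ - ν| := by
  rw [bigT, tau_eq ht hν, Real.div_rpow zero_le_one (by linarith), Real.one_rpow]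

lemma errRate_eq {t : ℝ} (ht : 0 < t) (hν : 0 < ν) (hγ : δ - ν < 0) (hF0 : 0 ≤ F z t 0)
    (hF : F z t 0 < 1)
    (hg : ∀ s : ℝ, 0 ≤ s → s < 1 → gf b s = -((1 - s) ^ δ * ell (1 / (1 - s)))) :
    errRate ν δ ell z t = errAt b |δ - ν| (F z t 0) := by
  have hv : 0 < 1 - F z t 0 := by linarith
  have h1 : (1 - F z t 0) ^ δ = (1 - F z t 0) ^ (2 * δ - ν) * (1 - F z t 0) ^ |δ - ν| := by
    rw [← Real.rpow_add hv, abs_of_neg hγ]; congr 1; ring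
  have h2 : (1 - F z t 0) ^ |δ - ν| ≠ 0 := (Real.rpow_pos_of_pos hv _).ne'
  rw [errRate, tau_eq ht hν, errAt, hg _ hF0 hF, neg_neg, Real.div_rpow zero_le_one hv.le,
    Real.one_rpow, div_div_eq_mul_div, div_one, h1]
  field_simp

/-- The relative error `ρ(t;s) = e^{T(t)} 𝒫(t;s) / π(s) - 1` is of the order of the error rate,
uniformly for `s ∈ [0,r]`. -/
lemma exists_relative_error_le (ha : IsOffspring a) (hc : IsCritical a) (hb : IsImmigration b)
    (hν : 0 < ν) (hγ : δ - ν < 0) (hμ : 0 < 2 * δ - ν) (hell : SlowlyVarying ell)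
    (hf : ∀ s : ℝ, 0 ≤ s → s < 1 → gf a s = (1 - s) ^ (1 + ν) * L (1 / (1 - s)))
    (hg : ∀ s : ℝ, 0 ≤ s → s < 1 → gf b s = -((1 - s) ^ δ * ell (1 / (1 - s))))
    (hCL : (fun x => ell x / L x - |δ - ν|) =O[atTop] (fun x => ell x / x ^ δ))
    (hp : IsMBPI a b p) (hz : IsMBP a z) {r : ℝ} (hr0 : 0 ≤ r) (hr : r < 1) :
    ∃ C, ∀ᶠ t in atTop, ∀ s ∈ Icc 0 r,
      |Real.exp (bigT ν δ z t) * P p t s / limitPi a b ν δ s - 1|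
        ≤ C * errAt b |δ - ν| (F z t 0) := by
  obtain ⟨hflow, -, hP⟩ := isFlow_F ha hc hz
  obtain ⟨C, u₀, hC, hu0, hu1, hlog⟩ :=
    exists_log_limitPi_sub_le ha hc hb hγ hμ hell hf hg hCL
  have hint := fun s h0 h1 =>
    intervalIntegrable_piIntegrand (s := s) ha hc hb hγ hμ hell hf hg hCL h0 h1
  have hmono := (flowTime_strictMonoOn ha hc).monotoneOn
  have hr0' : 0 ≤ flowTime a r := by
    have := hmono (mem_Iio.2 (zero_lt_one (α := ℝ))) hr hr0
    rwa [flowTime_zero] at this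
  set K := C * (1 + flowTime a r) with hK
  have hKpos : 0 < K := by positivity
  have hlim := ((tendsto_errAt ha hb hγ hμ hell hf hg hCL).comp hflow.tendsto).const_mul K
  rw [mul_zero] at hlim
  refine ⟨2 * K, ?_⟩
  filter_upwards [hlim.eventually (gt_mem_nhds one_pos), eventually_gt_atTop 0,
    hflow.tendsto.eventually (Ioo_mem_nhdsLT hu1)] with t hsmall ht hx s hs
  simp only [Function.comp_apply] at hsmall
  have hs1 : s < 1 := hs.2.trans_lt hr
  have hy1 := hflow.lt_one t s ht.le hs.1 hs1
  have hsy := hflow.le t s ht.le hs.1 hs1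
  have htime := hflow.time t s ht.le hs.1 hs1
  have htime0 := hflow.time t 0 ht.le le_rfl one_pos
  rw [flowTime_zero, zero_add] at htime0
  have hfs : 0 ≤ flowTime a s ∧ flowTime a s ≤ flowTime a r := by
    refine ⟨?_, hmono hs1 hr hs.2⟩
    have := hmono (mem_Iio.2 (zero_lt_one (α := ℝ))) hs1 hs.1
    rwa [flowTime_zero] at this
  have hxy : F z t 0 ≤ F z t s := by
    refine ((flowTime_strictMonoOn ha hc).le_iff_le hx.2 hy1).1 ?_
    rw [htime, htime0]; linarith [hfs.1]
  have hE := errAt_nonneg hb (κ := |δ - ν|) (hu0.trans hx.1.le) hx.2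
  have hw := hlog _ _ hx.1.le hxy hy1
  rw [htime, htime0, add_sub_cancel_right] at hw
  have hw2 : C * (1 + flowTime a s) * errAt b |δ - ν| (F z t 0)
      ≤ K * errAt b |δ - ν| (F z t 0) := by
    rw [hK]
    have := hfs.2
    gcongr
  have hkey : Real.exp (bigT ν δ z t) * P p t s / limitPi a b ν δ s
      = Real.exp (1 / (1 - F z t 0) ^ |δ - ν| - (1 / (1 - F z t s) ^ |δ - ν|
        + ∫ u in (F z t s)..1, piIntegrand a b ν δ u)) := by
    have h1 := hP b p hb.nonneg hb.hasSum_zero hp t s ht.le hs.1 hs1 0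
    rw [pow_zero, one_mul] at h1
    have h2 := limitPi_eq_mul_exp ha hc hb.hasSum_zero.summable hint hs.1 hsy hy1
    have h3 := (limitPi_pos (a := a) (b := b) (ν := ν) (δ := δ) (F z t s)).ne'
    have h4 : P p t s = Real.exp (immigrationExp a b (F z t s) - immigrationExp a b s) := h1
    have h5 := (Real.exp_pos (immigrationExp a b (F z t s) - immigrationExp a b s)).ne'
    rw [Real.exp_sub, h2, h4, ← bigT_eq ht hν hx.2]
    change _ = Real.exp (bigT ν δ z t) / limitPi a b ν δ (F z t s)
    field_simp
  rw [hkey]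
  refine (Real.abs_exp_sub_one_le ?_).trans ?_
  · linarith
  · linarith

/-! ### Coefficients -/

/-- The forward equation at time `t` equated with the backward one, for the chain started from
`0`. In terms of generating functions it reads `f 𝒫' + g 𝒫 = g(F) 𝒫`. -/
lemma sum_mul_rates_eq (ha : IsOffspring a) (hc : IsCritical a) (hb : IsImmigration b)
    (hp : IsMBPI a b p) (hz : IsMBP a z) {t : ℝ} (ht : 0 ≤ t) (j : ℕ) :
    ∑ m ∈ Finset.range (j + 2), p t 0 m * rates a b m j = ∑' k, b k * p t k j := by
  obtain ⟨hflow, -, hP⟩ := isFlow_F ha hc hz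
  have hp' : IsTransitionFunction (rates a b) p := hp
  have has := ha.hasSum_zero.summable
  have hbs := hb.hasSum_zero.summable
  have hp1 : ∀ j, |p t 0 j| ≤ 1 := fun j => by
    rw [abs_of_nonneg (hp'.nonneg t ht 0 j)]; exact hp'.le_one ht 0 j
  have hl : ∀ j, ∑ m ∈ Finset.range (j + 2), p t 0 m * rates a b m j
      = ∑' m, p t 0 m * rates a b m j := fun j => by
    refine (tsum_eq_sum fun m hm => ?_).symm
    have : j + 2 ≤ m := by simpa using hm
    rw [rates_eq_zero a b (by omega), mul_zero]
  rw [hl]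
  refine coeff_ext (c := fun j => ∑' m, p t 0 m * rates a b m j)
    (d := fun j => ∑' k, b k * p t k j)
    (S := fun x => gf b (F z t x) * gf (p t 0) x) (fun x hx0 hx1 => ?_) (fun x hx0 hx1 => ?_) j
  · have hS1 := summable_succ_mul_pow hp1 hx0.le hx1
    have hS0 := summable_mul_pow (hp'.hasSum_one t ht 0).summable hx0.le hx1.le
    have hsum : Summable fun m => |p t 0 m| * (m * x ^ (m - 1) * gf (fun k => |a k|) x
        + x ^ m * gf (fun k => |b k|) x) := by
      refine ((hS1.mul_right (gf (fun k => |a k|) x)).add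
        (hS0.mul_right (gf (fun k => |b k|) x))).congr fun m => ?_
      rw [abs_of_nonneg (hp'.nonneg t ht 0 m)]; ring
    have h := hasSum_tsum_mul_comm (c := p t 0) (d := fun m j => rates a b m j * x ^ j)
      (e := fun m j => rates (fun k => |a k|) (fun k => |b k|) m j * x ^ j) (fun m j => ?_)
      (fun m => hasSum_rates_mul_pow has.abs hbs.abs hx0.le hx1.le m) hsum
      (fun m => hasSum_rates_mul_pow has hbs hx0.le hx1.le m)
    · have hval : ∑' m, p t 0 m * (m * x ^ (m - 1) * gf a x + x ^ m * gf b x)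
          = gf b (F z t x) * gf (p t 0) x := by
        have h1 : ∑' m, p t 0 m * (m * x ^ (m - 1) * gf a x + x ^ m * gf b x)
            = (∑' m : ℕ, (m : ℝ) * p t 0 m * x ^ (m - 1)) * gf a x + gf (p t 0) x * gf b x := by
          rw [← tsum_mul_right, show gf (p t 0) x = ∑' m, p t 0 m * x ^ m from rfl, ← tsum_mul_right,
            ← (hS1.mul_right (gf a x)).tsum_add (hS0.mul_right (gf b x))]
          exact tsum_congr fun m => by ring
        have hy1 := hflow.lt_one t x ht hx0.le hx1
        have hy0 := hx0.le.trans (hflow.le t x ht hx0.le hx1)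
        have hd1 := hasDerivAt_gf hp1 hx0 hx1
        have hd2 : HasDerivAt (gf (p t 0)) (gf (p t 0) x *
            (gf b (F z t x) / gf a (F z t x) * (gf a (F z t x) / gf a x) - gf b x / gf a x))
            x := by
          have he : gf (p t 0) =ᶠ[𝓝 x]
              fun s => Real.exp (immigrationExp a b (F z t s) - immigrationExp a b s) := by
            filter_upwards [Ioo_mem_nhds hx0 hx1] with s hs
            have := hP b p hb.nonneg hb.hasSum_zero hp t s ht hs.1.le hs.2 0
            rwa [pow_zero, one_mul] at this
          have hd3 := hasDerivAt_immigrationExp ha hc hbs hy1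
          have hd4 := hasDerivAt_immigrationExp ha hc hbs hx1
          rw [max_eq_left hy0] at hd3
          rw [max_eq_left hx0.le] at hd4
          have hd5 := ((hd3.comp x (hflow.hasDerivAt t x ht hx0 hx1)).sub hd4).exp
          rw [he.eq_of_nhds]
          exact hd5.congr_of_eventuallyEq he
        rw [h1, hd1.unique hd2]
        have hfx := (ha.gf_pos hc hx0.le hx1).ne'
        have hfy := (ha.gf_pos hc hy0 hy1).ne'
        field_simp
        ring
      rw [hval] at h
      refine h.congr_fun fun j => ?_
      rw [← tsum_mul_right]
      exact tsum_congr fun m => by ring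
    · rw [abs_mul, abs_of_nonneg (pow_nonneg hx0.le j)]
      exact mul_le_mul_of_nonneg_right (abs_rates_le a b m j) (pow_nonneg hx0.le j)
  · have hPk := fun k => hP b p hb.nonneg hb.hasSum_zero hp t x ht hx0.le hx1 k
    have hy1 := hflow.lt_one t x ht hx0.le hx1
    have hy0 := hx0.le.trans (hflow.le t x ht hx0.le hx1)
    have hg0 : gf (p t 0) x = Real.exp (immigrationExp a b (F z t x) - immigrationExp a b x) := by
      rw [hPk 0, pow_zero, one_mul]
    have hbF := summable_mul_pow hbs hy0 hy1.le
    have hk : ∀ k, HasSum (fun j => p t k j * x ^ j) (gf (p t k) x) := fun k =>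
      hasSum_gf (hp'.hasSum_one t ht k).summable hx0.le hx1.le
    have hsum : Summable fun k => |b k| * gf (p t k) x := by
      refine ((summable_mul_pow hbs.abs hy0 hy1.le).mul_right (gf (p t 0) x)).congr fun k => ?_
      rw [hPk k, hg0]; ring
    have h := hasSum_tsum_mul_comm (c := b) (d := fun k j => p t k j * x ^ j)
      (e := fun k j => p t k j * x ^ j) (fun k j => le_of_eq (abs_of_nonneg
        (mul_nonneg (hp'.nonneg t ht k j) (pow_nonneg hx0.le j)))) hk hsum hk
    have hval : ∑' k, b k * gf (p t k) x = gf b (F z t x) * gf (p t 0) x := by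
      rw [gf, ← tsum_mul_right]
      refine tsum_congr fun k => ?_
      rw [hPk k, hg0]; ring
    rw [hval] at h
    refine h.congr_fun fun j => ?_
    rw [← tsum_mul_right]
    exact tsum_congr fun m => by ring

/-- The chain started from `k` is the chain started from `0` plus the independent descendants of
`k` ancestors. -/
lemma transition_eq_sum (ha : IsOffspring a) (hc : IsCritical a) (hb : IsImmigration b)
    (hp : IsMBPI a b p) (hz : IsMBP a z) {t : ℝ} (ht : 0 ≤ t) (k j : ℕ) :
    p t k j = ∑ l ∈ Finset.range (j + 1), z t k l * p t 0 (j - l) := by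
  obtain ⟨-, hzk, hP⟩ := isFlow_F ha hc hz
  have hp' : IsTransitionFunction (rates a b) p := hp
  have hz' : IsTransitionFunction (rates a fun _ => 0) z := hz
  refine coeff_ext (c := p t k)
    (d := fun j => ∑ l ∈ Finset.range (j + 1), z t k l * p t 0 (j - l))
    (S := gf (p t k)) (fun x hx0 hx1 => hasSum_gf (hp'.hasSum_one t ht k).summable hx0.le hx1.le)
    (fun x hx0 hx1 => ?_) j
  have h1 := (summable_mul_pow (hz'.hasSum_one t ht k).summable hx0.le hx1.le).norm
  have h2 := (summable_mul_pow (hp'.hasSum_one t ht 0).summable hx0.le hx1.le).norm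
  have h3 := (summable_norm_sum_mul_antidiagonal_of_summable_norm h1 h2).of_norm.hasSum
  rw [← tsum_mul_tsum_eq_tsum_sum_antidiagonal_of_summable_norm h1 h2] at h3
  have h4 : gf (p t k) x = (∑' l, z t k l * x ^ l) * ∑' m, p t 0 m * x ^ m := by
    have e1 := hP b p hb.nonneg hb.hasSum_zero hp t x ht hx0.le hx1 k
    have e2 := hP b p hb.nonneg hb.hasSum_zero hp t x ht hx0.le hx1 0
    rw [pow_zero, one_mul] at e2
    rw [e1, ← e2, ← hzk t x ht hx0.le hx1 k]
    rfl
  rw [h4]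
  refine h3.congr_fun fun n => ?_
  rw [Finset.sum_mul, Finset.Nat.sum_antidiagonal_eq_sum_range_succ
    (fun l m => z t k l * x ^ l * (p t 0 m * x ^ m))]
  refine Finset.sum_congr rfl fun l hl => ?_
  have : x ^ n = x ^ l * x ^ (n - l) := by
    rw [← pow_add, Nat.add_sub_cancel' (Nat.lt_succ_iff.1 (Finset.mem_range.1 hl))]
  rw [this]; ring

/-- The influence of `k` ancestors is at most the probability `1 - F(t;0) ^ k` that their
descendants survive. -/
lemma abs_transition_sub_le (ha : IsOffspring a) (hc : IsCritical a) (hb : IsImmigration b)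
    (hp : IsMBPI a b p) (hz : IsMBP a z) {t : ℝ} (ht : 0 ≤ t) (k j : ℕ) :
    |p t k j - p t 0 j| ≤ (1 - F z t 0 ^ k) * ∑ m ∈ Finset.range (j + 1), p t 0 m := by
  have hp' : IsTransitionFunction (rates a b) p := hp
  have hz' : IsTransitionFunction (rates a fun _ => 0) z := hz
  have hz0 : z t k 0 = F z t 0 ^ k := by
    rw [← (isFlow_F ha hc hz).2.1 t 0 ht le_rfl one_pos k, gf_zero]
  set S := ∑ m ∈ Finset.range (j + 1), p t 0 m with hS
  have hle : ∀ m, m ≤ j → p t 0 m ≤ S := fun m hm =>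
    Finset.single_le_sum (fun i _ => hp'.nonneg t ht 0 i) (Finset.mem_range.2 (by omega))
  have hS0 : 0 ≤ S := (hp'.nonneg t ht 0 0).trans (hle 0 (Nat.zero_le _))
  have hz1 : z t k 0 ≤ 1 := hz'.le_one ht k 0
  have hrest : ∑ l ∈ Finset.range j, z t k (l + 1) ≤ 1 - z t k 0 := by
    have := sum_le_hasSum (Finset.range (j + 1)) (fun i _ => hz'.nonneg t ht k i)
      (hz'.hasSum_one t ht k)
    rw [Finset.sum_range_succ'] at this
    linarith
  rw [transition_eq_sum ha hc hb hp hz ht k j, Finset.sum_range_succ', Nat.sub_zero, ← hz0]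
  have hA0 : 0 ≤ ∑ l ∈ Finset.range j, z t k (l + 1) * p t 0 (j - (l + 1)) :=
    Finset.sum_nonneg fun l _ => mul_nonneg (hz'.nonneg t ht k _) (hp'.nonneg t ht 0 _)
  have hA1 : ∑ l ∈ Finset.range j, z t k (l + 1) * p t 0 (j - (l + 1)) ≤ (1 - z t k 0) * S := by
    calc _ ≤ ∑ l ∈ Finset.range j, z t k (l + 1) * S :=
          Finset.sum_le_sum fun l _ => mul_le_mul_of_nonneg_left (hle _ (Nat.sub_le _ _))
            (hz'.nonneg t ht k _)
      _ ≤ _ := by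
          rw [← Finset.sum_mul]
          gcongr
  have hB0 : 0 ≤ (1 - z t k 0) * p t 0 j :=
    mul_nonneg (by linarith) (hp'.nonneg t ht 0 j)
  have hB1 : (1 - z t k 0) * p t 0 j ≤ (1 - z t k 0) * S :=
    mul_le_mul_of_nonneg_left (hle j le_rfl) (by linarith)
  rw [abs_le]
  constructor <;> linarith

lemma abs_tsum_immigration_le (ha : IsOffspring a) (hc : IsCritical a) (hb : IsImmigration b)
    (hp : IsMBPI a b p) (hz : IsMBP a z) {t : ℝ} (ht : 0 ≤ t) (j : ℕ) :
    |∑' k, b k * p t k j| ≤ -gf b (F z t 0) * ∑ m ∈ Finset.range (j + 1), p t 0 m := by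
  have hp' : IsTransitionFunction (rates a b) p := hp
  obtain ⟨hx0, hx1⟩ := F_zero_mem ha hc hz ht
  have hs : Summable fun k => b k * p t k j := by
    refine Summable.of_norm_bounded hb.hasSum_zero.summable.abs fun k => ?_
    rw [norm_mul, Real.norm_eq_abs, Real.norm_eq_abs, abs_of_nonneg (hp'.nonneg t ht k j)]
    exact mul_le_of_le_one_right (abs_nonneg _) (hp'.le_one ht k j)
  -- the immigration rates sum to `0`, so the value at the state `0` may be subtracted
  have h1 := hs.hasSum.sub (hb.hasSum_zero.mul_right (p t 0 j))
  rw [zero_mul, sub_zero] at h1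
  have h2 := (neg_gf_eq hb.hasSum_zero hx0 hx1.le).mul_right (∑ m ∈ Finset.range (j + 1), p t 0 m)
  rw [← h1.tsum_eq, ← Real.norm_eq_abs]
  refine tsum_of_norm_bounded h2 fun k => ?_
  rw [← mul_sub, norm_mul, Real.norm_eq_abs, Real.norm_eq_abs]
  by_cases hk : k = 0
  · simp [hk]
  · rw [abs_of_nonneg (hb.nonneg k hk), mul_assoc]
    exact mul_le_mul_of_nonneg_left (abs_transition_sub_le ha hc hb hp hz ht k j) (hb.nonneg k hk)

/-- Abstract form of the convergence of coefficients: `E` stands for `e^{T(t)}`, and `err` for an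
upper bound of `-g(F(t;0))`. The coefficients follow from that of `s ^ 0` by the recursion
`sum_mul_rates_eq`. -/
lemma exists_coeff_limit (ha : IsOffspring a) (hc : IsCritical a) (hb : IsImmigration b)
    (hp : IsMBPI a b p) (hz : IsMBP a z) {E err : ℝ → ℝ}
    (herr : ∀ᶠ t in atTop, -gf b (F z t 0) ≤ err t) (hlim : Tendsto err atTop (𝓝 0)) {c₀ : ℝ}
    (h0 : (fun t => E t * p t 0 0 - c₀) =O[atTop] err) (j : ℕ) :
    ∃ c, ∀ i, (fun t => E t * p t i j - c) =O[atTop] err := by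
  have hp' : IsTransitionFunction (rates a b) p := hp
  have hkO : (fun t => -gf b (F z t 0)) =O[atTop] err := by
    refine IsBigO.of_bound 1 ?_
    filter_upwards [herr, eventually_ge_atTop 0] with t h ht
    obtain ⟨hx0, hx1⟩ := F_zero_mem ha hc hz ht
    have h2 := neg_gf_nonneg hb.nonneg hb.hasSum_zero hx0 hx1.le
    rw [one_mul, Real.norm_of_nonneg h2, Real.norm_of_nonneg (h2.trans h)]
    exact h
  have hbdd : ∀ {m : ℕ} {c : ℝ}, (fun t => E t * p t 0 m - c) =O[atTop] err →
      (fun t => E t * p t 0 m) =O[atTop] (fun _ => (1 : ℝ)) := by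
    intro m c h
    have h1 := (h.trans (hlim.isBigO_one ℝ)).add (isBigO_const_const c one_ne_zero atTop)
    simpa using h1
  have hSb : ∀ {c : ℕ → ℝ} {j : ℕ}, (∀ m ≤ j, (fun t => E t * p t 0 m - c m) =O[atTop] err) →
      (fun t => E t * ∑ m ∈ Finset.range (j + 1), p t 0 m) =O[atTop] (fun _ => (1 : ℝ)) := by
    intro c j h
    simp only [Finset.mul_sum]
    exact IsBigO.fun_sum fun m hm => hbdd (h m (Nat.lt_succ_iff.1 (Finset.mem_range.1 hm)))
  have hzero : ∀ j, ∃ c, (fun t => E t * p t 0 j - c) =O[atTop] err := by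
    intro j
    induction j using Nat.strong_induction_on with
    | _ j ih =>
      cases j with
      | zero => exact ⟨c₀, h0⟩
      | succ j =>
        choose! c hcm using ih
        have hcm' : ∀ m ≤ j, (fun t => E t * p t 0 m - c m) =O[atTop] err :=
          fun m hm => hcm m (Nat.lt_succ_of_le hm)
        refine ⟨-(∑ m ∈ Finset.range (j + 1), rates a b m j * c m) / ((j + 1) * a 0), ?_⟩
        have hR : (fun t => E t * ∑' k, b k * p t k j) =O[atTop] err := by
          have h1 := hkO.mul (hSb hcm')
          simp only [mul_one] at h1
          refine IsBigO.trans (IsBigO.of_bound 1 ?_) h1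
          filter_upwards [eventually_ge_atTop 0] with t ht
          obtain ⟨hx0, hx1⟩ := F_zero_mem ha hc hz ht
          have h2 := abs_tsum_immigration_le ha hc hb hp hz ht j
          rw [one_mul, norm_mul, norm_mul, norm_mul, mul_left_comm]
          refine mul_le_mul_of_nonneg_left ?_ (norm_nonneg _)
          rw [← norm_mul]
          exact h2.trans (le_abs_self _)
        have hsum : (fun t => ∑ m ∈ Finset.range (j + 1),
            rates a b m j * (E t * p t 0 m - c m)) =O[atTop] err :=
          IsBigO.fun_sum fun m hm => (hcm' m
            (Nat.lt_succ_iff.1 (Finset.mem_range.1 hm))).const_mul_left _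
        refine ((hR.sub hsum).const_mul_left (((j : ℝ) + 1) * a 0)⁻¹).congr' ?_ EventuallyEq.rfl
        filter_upwards [eventually_ge_atTop 0] with t ht
        have h3 := sum_mul_rates_eq ha hc hb hp hz ht j
        rw [Finset.sum_range_succ, rates_succ] at h3
        rw [← h3]
        simp only [mul_sub, Finset.sum_sub_distrib]
        have h4 : ∑ m ∈ Finset.range (j + 1), rates a b m j * (E t * p t 0 m)
            = E t * ∑ m ∈ Finset.range (j + 1), p t 0 m * rates a b m j := by
          rw [Finset.mul_sum]
          exact Finset.sum_congr rfl fun m _ => by ring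
        rw [h4]
        have ha0 := ha.zero_pos.ne'
        have hj : (j : ℝ) + 1 ≠ 0 := by positivity
        field_simp
        ring
  choose c hcm using hzero
  refine ⟨c j, fun i => ?_⟩
  obtain ⟨κ, hκ, hlow⟩ := hb.le_neg_gf
  have hdiff : (fun t => E t * (p t i j - p t 0 j)) =O[atTop] err := by
    have h1 := hkO.mul (hSb (j := j) fun m _ => hcm m)
    simp only [mul_one] at h1
    refine IsBigO.trans (IsBigO.of_bound (i / κ) ?_) h1
    filter_upwards [eventually_ge_atTop 0] with t ht
    obtain ⟨hx0, hx1⟩ := F_zero_mem ha hc hz ht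
    have h2 := abs_transition_sub_le ha hc hb hp hz ht i j
    have hS0 : 0 ≤ ∑ m ∈ Finset.range (j + 1), p t 0 m :=
      Finset.sum_nonneg fun m _ => hp'.nonneg t ht 0 m
    have h3 : 1 - F z t 0 ^ i ≤ i / κ * -gf b (F z t 0) := by
      have h4 := one_add_mul_le_pow (show (-2 : ℝ) ≤ F z t 0 - 1 by linarith) i
      rw [add_sub_cancel] at h4
      have h5 := hlow _ hx0 hx1.le
      have h6 : (i : ℝ) * (1 - F z t 0) ≤ i / κ * -gf b (F z t 0) := by
        rw [div_mul_eq_mul_div, le_div_iff₀ hκ, mul_assoc, mul_comm (1 - F z t 0)]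
        gcongr
      linarith
    have hk0 := neg_gf_nonneg hb.nonneg hb.hasSum_zero hx0 hx1.le
    rw [norm_mul, norm_mul, norm_mul, Real.norm_of_nonneg hk0, Real.norm_of_nonneg hS0]
    calc ‖E t‖ * ‖p t i j - p t 0 j‖
        ≤ ‖E t‖ * (i / κ * -gf b (F z t 0) * ∑ m ∈ Finset.range (j + 1), p t 0 m) := by
          refine mul_le_mul_of_nonneg_left (h2.trans ?_) (norm_nonneg _)
          gcongr
      _ = _ := by ring
  refine (hdiff.add (hcm j)).congr_left fun t => ?_
  ring

end Main

/-! ### The invariant measure -/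

section Invariant
variable {a b : ℕ → ℝ} {ν δ : ℝ} {p z : ℝ → ℕ → ℕ → ℝ}

/-- Tannery's theorem for generating functions: convergence at some `r > s` dominates the terms
at `s`. -/
lemma hasSum_of_tendsto_coeff {w : ℝ → ℕ → ℝ} {c : ℕ → ℝ} {S r s : ℝ} {R : ℝ}
    (hw : ∀ᶠ t in atTop, ∀ j, 0 ≤ w t j) (hws : ∀ᶠ t in atTop, Summable (w t))
    (hcoeff : ∀ j, Tendsto (fun t => w t j) atTop (𝓝 (c j))) (hs0 : 0 ≤ s) (hsr : s < r)
    (hr : r < 1) (hS : Tendsto (fun t => gf (w t) s) atTop (𝓝 S))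
    (hR : Tendsto (fun t => gf (w t) r) atTop (𝓝 R)) : HasSum (fun j => c j * s ^ j) S := by
  have hr0 : 0 < r := hs0.trans_lt hsr
  have hbound : ∀ᶠ t in atTop, ∀ j, ‖w t j * s ^ j‖ ≤ (R + 1) * (s / r) ^ j := by
    filter_upwards [hw, hws, hR.eventually (gt_mem_nhds (lt_add_one R))] with t h1 h2 h3 j
    rw [Real.norm_of_nonneg (mul_nonneg (h1 j) (pow_nonneg hs0 j))]
    have h4 : w t j * r ^ j ≤ R + 1 := (le_hasSum (hasSum_gf h2 hr0.le hr.le) j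
      fun i _ => mul_nonneg (h1 i) (pow_nonneg hr0.le i)).trans h3.le
    have h5 : w t j * s ^ j = w t j * r ^ j * (s / r) ^ j := by
      rw [div_pow]; field_simp
    rw [h5]
    gcongr
  have hgeo : Summable fun j => (R + 1) * (s / r) ^ j :=
    (summable_geometric_of_lt_one (by positivity) ((div_lt_one hr0).2 hsr)).mul_left _
  have hlim := fun j => (hcoeff j).mul_const (s ^ j)
  have hsum : Summable fun j => c j * s ^ j := by
    refine Summable.of_norm_bounded hgeo fun j => ?_
    exact le_of_tendsto (hlim j).norm (hbound.mono fun t h => h j)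
  have h := tendsto_tsum_of_dominated_convergence hgeo hlim hbound
  rw [tendsto_nhds_unique hS h]
  exact hsum.hasSum

lemma hasSum_invariant (ha : IsOffspring a) (hc : IsCritical a) (hb : IsImmigration b)
    (hint : ∀ s : ℝ, 0 ≤ s → s < 1 → IntervalIntegrable (piIntegrand a b ν δ) volume s 1)
    (hp : IsMBPI a b p) (hz : IsMBP a z) {ϖ : ℕ → ℝ} (hϖ0 : ∀ j, 0 ≤ ϖ j)
    (hϖ : ∀ s : ℝ, 0 ≤ s → s < 1 → HasSum (fun j => ϖ j * s ^ j) (limitPi a b ν δ s))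
    {t : ℝ} (ht : 0 ≤ t) (j : ℕ) : HasSum (fun i => ϖ i * p t i j) (ϖ j) := by
  obtain ⟨hflow, -, hP⟩ := isFlow_F ha hc hz
  have hp' : IsTransitionFunction (rates a b) p := hp
  have hk : ∀ x : ℝ, 0 < x → x < 1 → ∀ i, HasSum (fun j => p t i j * x ^ j) (gf (p t i) x) :=
    fun x hx0 hx1 i => hasSum_gf (hp'.hasSum_one t ht i).summable hx0.le hx1.le
  have habs : ∀ x : ℝ, 0 < x → ∀ i j, |p t i j * x ^ j| ≤ p t i j * x ^ j := fun x hx i j =>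
    le_of_eq (abs_of_nonneg (mul_nonneg (hp'.nonneg t ht i j) (pow_nonneg hx.le j)))
  -- `∑ ϖ_i F ^ i 𝒫 = π(F) 𝒫 = π`
  have hval : ∀ x : ℝ, 0 < x → x < 1 →
      HasSum (fun i => ϖ i * gf (p t i) x) (limitPi a b ν δ x) := by
    intro x hx0 hx1
    have hxy := hflow.le t x ht hx0.le hx1
    have hy1 := hflow.lt_one t x ht hx0.le hx1
    rw [limitPi_eq_mul_exp ha hc hb.hasSum_zero.summable hint hx0.le hxy hy1]
    refine ((hϖ _ (hx0.le.trans hxy) hy1).mul_right _).congr_fun fun i => ?_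
    rw [hP b p hb.nonneg hb.hasSum_zero hp t x ht hx0.le hx1 i, mul_assoc]
  have hvalabs : ∀ x : ℝ, 0 < x → x < 1 → Summable fun i => |ϖ i| * gf (p t i) x :=
    fun x hx0 hx1 => (hval x hx0 hx1).summable.congr fun i => by rw [abs_of_nonneg (hϖ0 i)]
  have hsum : Summable fun i => ϖ i * p t i j := by
    have h := (summable_mul_of_abs_le (habs (1 / 2) (by norm_num))
      (hk (1 / 2) (by norm_num) (by norm_num))
      (hvalabs (1 / 2) (by norm_num) (by norm_num))).prod_symm.prod_factor j
    refine (h.mul_right (2 ^ j)).congr fun i => ?_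
    change ϖ i * (p t i j * (1 / 2) ^ j) * 2 ^ j = _
    rw [← mul_assoc, mul_assoc _ ((1 / 2 : ℝ) ^ j), ← mul_pow]
    norm_num
  have heq := coeff_ext (c := fun j => ∑' i, ϖ i * p t i j) (d := ϖ) (S := limitPi a b ν δ)
    (fun x hx0 hx1 => ?_) (fun x hx0 hx1 => hϖ x hx0.le hx1) j
  · rw [← heq]; exact hsum.hasSum
  · have h := hasSum_tsum_mul_comm (c := ϖ) (habs x hx0) (hk x hx0 hx1) (hvalabs x hx0 hx1)
      (hk x hx0 hx1)
    rw [(hval x hx0 hx1).tsum_eq] at h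
    refine h.congr_fun fun j => ?_
    rw [← tsum_mul_right]
    exact tsum_congr fun m => by ring

lemma IsTransitionFunction.exists_pos_of_rate {q : ℕ → ℕ → ℝ} (hp : IsTransitionFunction q p)
    {i j : ℕ} (hij : i ≠ j) (hq : 0 < q i j) : ∃ h, 0 ≤ h ∧ 0 < p h i j := by
  obtain ⟨h, h1, h2⟩ := (((hp.tendsto_quotient i j).eventually (lt_mem_nhds hq)).and
    self_mem_nhdsWithin).exists
  rw [if_neg hij, sub_zero] at h1
  exact ⟨h, le_of_lt h2, (div_pos_iff_of_pos_right h2).1 h1⟩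

/-- An invariant measure charging `0` charges every state: by immigration the chain climbs from `k`
to `k + m`, and by deaths it steps down by one. -/
lemma invariant_pos (ha : IsOffspring a) (hb : IsImmigration b) (hp : IsMBPI a b p) {ϖ : ℕ → ℝ}
    (hϖ0 : ∀ j, 0 ≤ ϖ j) (hinv : ∀ t, 0 ≤ t → ∀ j, HasSum (fun i => ϖ i * p t i j) (ϖ j))
    (h0 : 0 < ϖ 0) (j : ℕ) : 0 < ϖ j := by
  have hp' : IsTransitionFunction (rates a b) p := hp
  have hstep : ∀ i j, i ≠ j → 0 < rates a b i j → 0 < ϖ i → 0 < ϖ j := by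
    intro i j hij hq hi
    obtain ⟨h, hh, hpos⟩ := hp'.exists_pos_of_rate hij hq
    exact (mul_pos hi hpos).trans_le (le_hasSum (hinv h hh j) i
      fun k _ => mul_nonneg (hϖ0 k) (hp'.nonneg h hh k j))
  have hdown : ∀ k, 0 < ϖ (k + 1) → 0 < ϖ k := fun k =>
    hstep (k + 1) k (by omega) (by
      rw [rates_succ]
      exact mul_pos (by positivity) ha.zero_pos)
  obtain ⟨m, hm, hbm⟩ := hb.exists_pos
  have hup : ∀ k, 0 < ϖ k → 0 < ϖ (k + m) := fun k =>
    hstep k (k + m) (by omega) (by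
      have h1 : 0 ≤ a (k + m + 1 - k) := ha.nonneg _ (by omega)
      rw [rates, if_pos (by omega), if_pos (by omega), Nat.add_sub_cancel_left]
      exact add_pos_of_nonneg_of_pos (mul_nonneg k.cast_nonneg h1) hbm)
  have hmul : ∀ n, 0 < ϖ (n * m) := fun n => by
    induction n with
    | zero => simpa using h0
    | succ n ih => rw [Nat.succ_mul]; exact hup _ ih
  have hle : ∀ d, 0 < ϖ (j + d) → 0 < ϖ j := fun d => by
    induction d with
    | zero => exact id
    | succ d ih => exact fun h => ih (hdown _ h)
  obtain ⟨d, hd⟩ := Nat.exists_eq_add_of_le (Nat.le_mul_of_pos_right j (Nat.pos_of_ne_zero hm))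
  exact hle d (hd ▸ hmul j)

end Invariant
end BranchingImmigration

theorem theorem2 (a b : ℕ → ℝ) (ha : IsOffspring a) (hb : IsImmigration b)
    (hcrit : IsCritical a)
    (ν δ : ℝ) (hν : 0 < ν ∧ ν < 1) (hδ : 0 < δ ∧ δ < 1)
    (L ell : ℝ → ℝ) (hL : SlowlyVarying L) (hell : SlowlyVarying ell)
    (hf : ∀ s : ℝ, 0 ≤ s → s < 1 → gf a s = (1 - s) ^ (1 + ν) * L (1 / (1 - s)))
    (hg : ∀ s : ℝ, 0 ≤ s → s < 1 → gf b s = -((1 - s) ^ δ * ell (1 / (1 - s))))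
    (p z : ℝ → ℕ → ℕ → ℝ) (hp : IsMBPI a b p) (hz : IsMBP a z)
    (hγ : δ - ν < 0) (hμ : 0 < 2 * δ - ν)
    (hCL : (fun x => ell x / L x - |δ - ν|) =O[atTop] (fun x => ell x / x ^ δ)) :
    (∀ s : ℝ, 0 ≤ s → s < 1 → IntervalIntegrable (piIntegrand a b ν δ) volume s 1) ∧
    (∃ ρ : ℝ → ℝ → ℝ,
      (∀ t s : ℝ, 0 ≤ t → 0 ≤ s → s < 1 →
        Real.exp (bigT ν δ z t) * P p t s = limitPi a b ν δ s * (1 + ρ t s)) ∧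
      (∀ r : ℝ, r < 1 → TendstoUniformlyOn ρ (fun _ => 0) atTop (Icc 0 r)) ∧
      (HasRemainder L ν → HasRemainder ell δ → ∀ r : ℝ, r < 1 →
        ∃ C : ℝ, ∀ᶠ t in atTop, ∀ s ∈ Icc (0 : ℝ) r, |ρ t s| ≤ C * |errRate ν δ ell z t|)) ∧
    (∃ ϖ : ℕ → ℝ,
      (∀ s : ℝ, 0 ≤ s → s < 1 → HasSum (fun j => ϖ j * s ^ j) (limitPi a b ν δ s)) ∧
      (HasRemainder L ν → HasRemainder ell δ → ∀ i j : ℕ, ∃ ε : ℝ → ℝ,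
        ε =O[atTop] errRate ν δ ell z ∧
        ∀ t : ℝ, 0 ≤ t → Real.exp (bigT ν δ z t) * p t i j = ϖ j * (1 + ε t)) ∧
      IsInvariantMeasure p ϖ) := by
  have hp' : IsTransitionFunction (rates a b) p := hp
  have hint := fun s h0 h1 => intervalIntegrable_piIntegrand (s := s) ha hcrit hb hγ hμ hell hf
    hg hCL h0 h1
  have hflow := (isFlow_F ha hcrit hz).1
  set err : ℝ → ℝ := fun t => errAt b |δ - ν| (F z t 0) with herr
  have herr0 : ∀ t, 0 ≤ t → 0 ≤ err t := fun t ht =>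
    have h := F_zero_mem ha hcrit hz ht
    errAt_nonneg hb h.1 h.2
  have herrlim : Tendsto err atTop (𝓝 0) :=
    (tendsto_errAt ha hb hγ hμ hell hf hg hCL).comp hflow.tendsto
  have herrEq : err =ᶠ[atTop] errRate ν δ ell z := by
    filter_upwards [eventually_gt_atTop 0] with t ht
    have h := F_zero_mem ha hcrit hz ht.le
    exact (errRate_eq ht hν.1 hγ h.1 h.2 hg).symm
  have hπ : ∀ s, 0 < limitPi a b ν δ s := fun s => limitPi_pos s
  set ρ : ℝ → ℝ → ℝ := fun t s => Real.exp (bigT ν δ z t) * P p t s / limitPi a b ν δ s - 1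
    with hρ
  have hρeq : ∀ t s, Real.exp (bigT ν δ z t) * P p t s = limitPi a b ν δ s * (1 + ρ t s) :=
    fun t s => by
      have := (hπ s).ne'
      simp only [hρ]
      field_simp
      ring
  have hρbound : ∀ r : ℝ, r < 1 → ∃ C, ∀ᶠ t in atTop, ∀ s ∈ Icc (0 : ℝ) r,
      |ρ t s| ≤ C * err t := by
    intro r hr
    obtain ⟨C, hC⟩ := exists_relative_error_le ha hcrit hb hν.1 hγ hμ hell hf hg hCL hp hz
      (le_max_right r 0) (max_lt hr one_pos)
    exact ⟨C, hC.mono fun t h s hs => h s ⟨hs.1, hs.2.trans (le_max_left _ _)⟩⟩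
  have hρunif : ∀ r : ℝ, r < 1 → TendstoUniformlyOn ρ (fun _ => 0) atTop (Icc 0 r) := by
    intro r hr
    obtain ⟨C, hC⟩ := hρbound r hr
    rw [Metric.tendstoUniformlyOn_iff]
    intro e he
    have hlim := herrlim.const_mul C
    rw [mul_zero] at hlim
    filter_upwards [hC, hlim.eventually (gt_mem_nhds he)] with t h1 h2 s hs
    rw [dist_comm, Real.dist_eq, sub_zero]
    exact (h1 s hs).trans_lt h2
  have hρlim : ∀ s : ℝ, 0 ≤ s → s < 1 →
      Tendsto (fun t => Real.exp (bigT ν δ z t) * P p t s) atTop (𝓝 (limitPi a b ν δ s)) := by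
    intro s h0 h1
    have h2 := ((hρunif s h1).tendsto_at (show s ∈ Icc 0 s from ⟨h0, le_rfl⟩)).const_add 1
      |>.const_mul (limitPi a b ν δ s)
    rw [add_zero, mul_one] at h2
    exact h2.congr fun t => (hρeq t s).symm
  have hP0 : ∀ t, P p t 0 = p t 0 0 := fun t => gf_zero _
  have hcoeff0 : (fun t => Real.exp (bigT ν δ z t) * p t 0 0 - limitPi a b ν δ 0)
      =O[atTop] err := by
    obtain ⟨C, hC⟩ := hρbound 0 one_pos
    refine IsBigO.of_bound (limitPi a b ν δ 0 * C) ?_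
    filter_upwards [hC, eventually_ge_atTop 0] with t h1 ht
    rw [← hP0, hρeq, mul_add, mul_one, add_sub_cancel_left, norm_mul,
      Real.norm_of_nonneg (hπ 0).le, Real.norm_of_nonneg (herr0 t ht), mul_assoc]
    exact mul_le_mul_of_nonneg_left (h1 0 ⟨le_rfl, le_rfl⟩) (hπ 0).le
  have hkerr : ∀ᶠ t in atTop, -gf b (F z t 0) ≤ err t := by
    filter_upwards [eventually_ge_atTop 0] with t ht
    have h := F_zero_mem ha hcrit hz ht
    exact neg_gf_le_errAt hb (abs_nonneg _) h.1 h.2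
  choose ϖ hϖ using exists_coeff_limit ha hcrit hb hp hz hkerr herrlim hcoeff0
  have hϖlim : ∀ j, Tendsto (fun t => Real.exp (bigT ν δ z t) * p t 0 j) atTop (𝓝 (ϖ j)) :=
    fun j => by
      have := ((hϖ j 0).trans_tendsto herrlim).add_const (ϖ j)
      simpa using this
  have hϖ0 : ∀ j, 0 ≤ ϖ j := fun j => ge_of_tendsto (hϖlim j) <| by
    filter_upwards [eventually_ge_atTop 0] with t ht
    exact mul_nonneg (Real.exp_pos _).le (hp'.nonneg t ht 0 j)
  have hϖsum : ∀ s : ℝ, 0 ≤ s → s < 1 →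
      HasSum (fun j => ϖ j * s ^ j) (limitPi a b ν δ s) := by
    intro s h0 h1
    obtain ⟨r, hsr, hr⟩ := exists_between h1
    have hgf : ∀ x t, gf (fun j => Real.exp (bigT ν δ z t) * p t 0 j) x
        = Real.exp (bigT ν δ z t) * P p t x := fun x t => by
      rw [P, gf, gf, ← tsum_mul_left]
      exact tsum_congr fun j => by ring
    refine hasSum_of_tendsto_coeff (w := fun t j => Real.exp (bigT ν δ z t) * p t 0 j) ?_ ?_ hϖlim
      h0 hsr hr (R := limitPi a b ν δ r) ?_ ?_
    · filter_upwards [eventually_ge_atTop 0] with t ht j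
      exact mul_nonneg (Real.exp_pos _).le (hp'.nonneg t ht 0 j)
    · filter_upwards [eventually_ge_atTop 0] with t ht
      exact (hp'.hasSum_one t ht 0).summable.mul_left _
    · simpa only [hgf] using hρlim s h0 h1
    · simpa only [hgf] using hρlim r (h0.trans hsr.le) hr
  have hinv : ∀ t, 0 ≤ t → ∀ j, HasSum (fun i => ϖ i * p t i j) (ϖ j) := fun t ht j =>
    hasSum_invariant ha hcrit hb hint hp hz hϖ0 hϖsum ht j
  have hϖzero : 0 < ϖ 0 := by
    have h := (hϖsum 0 le_rfl one_pos).tsum_eq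
    rw [tsum_eq_single 0 (fun j hj => by simp [hj]), pow_zero, mul_one] at h
    rw [h]
    exact hπ 0
  have hϖpos := invariant_pos ha hb hp hϖ0 hinv hϖzero
  refine ⟨hint, ⟨ρ, fun t s _ _ _ => hρeq t s, hρunif, fun _ _ r hr => ?_⟩,
    ϖ, hϖsum, fun _ _ i j => ?_, hϖ0, ⟨0, hϖzero.ne'⟩, hinv⟩
  · obtain ⟨C, hC⟩ := hρbound r hr
    refine ⟨C, ?_⟩
    filter_upwards [hC, herrEq, eventually_ge_atTop 0] with t h1 h2 ht s hs
    rw [← h2, abs_of_nonneg (herr0 t ht)]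
    exact h1 s hs
  · refine ⟨fun t => Real.exp (bigT ν δ z t) * p t i j / ϖ j - 1, ?_, fun t _ => ?_⟩
    · refine (((hϖ j i).const_mul_left (ϖ j)⁻¹).congr' ?_ herrEq)
      filter_upwards with t
      have := (hϖpos j).ne'
      field_simp
    · have := (hϖpos j).ne'
      field_simp
      ring
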